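/- **Theorem 1.** *Model.* For every sample size $N$ let $p=p_N$ be a dimension, $\theta=\theta_N\in\mathbb{R}^{p}\setminus\{0\}$, and let $s=s_N$ be the number of non-zero coordinates of $\theta$. Assume $s=o(p)$ and $p=o(N)$ as $N\to\infty$. The observations $(x,y)$ follow the single index model with measurement error $$y=g(\theta^\top z)+\varepsilon,\qquad x=z+\xi,$$ with $z,\xi,\varepsilon$ independent, where $\varepsilon$ is centred and sub-Gaussian with a variance proxy that does not depend on $N$, where $\xi$ has mean $0$ and covariance $\sigma_\xi^2 I$ (any $\sigma_\xi$ and any such law), and where $g:\mathbb{R}\to\mathbb{R}$ is continuously differentiable with $c_0<g'<c_1$ on $\mathbb{R}$ for constants $c_0,c_1>0$ that do not depend on $N$. ($g$ and the laws of $\xi$ and $\varepsilon$ may depend on $N$.) *Procedures.* Let $(x_i,y_i)_{i=1}^N$ be i.i.d. from the model. Fix $\alpha>0$ and bandwidths $\sigma_x,\sigma_y>0$ (which may depend on $N$). Given the data, a mixup procedure draws, independently for $i=1,\dots,N$, a partner $j\neq i$ with probability proportional to $w_{ij}$ and a ratio $\lambda_i\sim\mathrm{Beta}(\alpha,\alpha)$,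 and forms $\tilde x_i=\lambda_i x_i+(1-\lambda_i)x_j$ and $\tilde y_i=\lambda_i y_i+(1-\lambda_i)y_j$. Here $w_{ij}=1$ for vanilla mixup, $w_{ij}=\exp(-\|x_i-x_j\|^2/(2\sigma_x^2))$ for mixup with feature similarity, and $w_{ij}=\exp(-(y_i-y_j)^2/(2\sigma_y^2))$ for C-Mixup; the three procedures are run independently on the same data. Each yields an estimate $\theta^*\in\arg\min_{b\in\mathbb{R}^p}\sum_{i=1}^N(\tilde y_i-\tilde x_i^\top b)^2$ (denoted $\theta^*_{mixup}$, $\theta^*_{feat}$, $\theta^*_{C\text{-}Mixup}$), and then, from the same augmented data, the kernel regression estimator $$\hat g(t;\theta^*)=\frac{\sum_{i=1}^N K_h(\theta^{*\top}\tilde x_i,t)\,\tilde y_i}{\sum_{i=1}^N K_h(\theta^{*\top}\tilde x_i,t)},\qquad K_h(t_1,t_2)=\kappa\Big(\frac{t_1-t_2}{h}\Big)$$ (with value $0$ where the denominator vanishes). Its error is $\mathrm{MSE}(\theta^*)=\mathbb{E}\big[(y-\hat g(\theta^{*\top}x;\theta^*))^2\big]$, the expectation being over a fresh observation $(x,y)$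 of the model only. *Claim.* There exist a number $K\ge1$ of components, a kernel $\kappa$ (measurable, non-negative, even, with integral $1$) and, for every $N$, centres $m_1,\dots,m_K\in\mathbb{R}$, a positive definite covariance matrix $\Sigma$ and a kernel bandwidth $h>0$ such that, if $z$ has the law $\frac1K\sum_{k=1}^K\mathcal{N}_p\big(m_k\theta/\|\theta\|,\Sigma\big)$ (a Gaussian mixture along $\theta$), then with probability $1-o(1)$ as $N\to\infty$ $$\mathrm{MSE}(\theta^*_{C\text{-}Mixup})<\min\big(\mathrm{MSE}(\theta^*_{feat}),\ \mathrm{MSE}(\theta^*_{mixup})\big)$$ for all least squares solutions $\theta^*$ of the three problems. -/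

import Mathlib

open MeasureTheory ProbabilityTheory Filter Topology Asymptotics
open scoped ENNReal NNReal

namespace CMixup

/-- The feature space `ℝ^p` with its Euclidean norm. -/
abbrev Feat (p : ℕ) : Type := EuclideanSpace ℝ (Fin p)

/-! ### The data-generating model -/

/-- The equally weighted mixture of the `K` Gaussian laws with common covariance matrix `S`, whose
centres `m k • θ / ‖θ‖` lie on the line spanned by `θ`. -/
noncomputable def gaussianMixture {p K : ℕ} (θ : Feat p) (m : Fin K → ℝ)
    (S : Matrix (Fin p) (Fin p) ℝ) : Measure (Feat p) :=
  (K : ℝ≥0∞)⁻¹ • ∑ k : Fin K, multivariateGaussian ((m k / ‖θ‖) • θ) S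

/-- `ξ` is the law of a random vector with mean `0` and covariance matrix `σ ^ 2 • I`. -/
structure IsIsotropicNoise {p : ℕ} (ξ : Measure (Feat p)) (σ : ℝ) : Prop where
  isProbabilityMeasure : IsProbabilityMeasure ξ
  memLp : MemLp (fun v : Feat p => v) 2 ξ
  mean : ∫ v, v ∂ξ = 0
  cov : ∀ u w : Feat p, ∫ v, inner ℝ u v * inner ℝ w v ∂ξ = σ ^ 2 * inner ℝ u w

/-- The law of one observation `(x, y)` of the single index model with measurement error:
`x = z + ξ` and `y = g (θᵀ z) + ε`, with `z`, `ξ`, `ε` independent and `z` drawn from the Gaussian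
mixture along `θ`. -/
noncomputable def obsLaw {p K : ℕ} (g : ℝ → ℝ) (θ : Feat p) (m : Fin K → ℝ)
    (S : Matrix (Fin p) (Fin p) ℝ) (ξLaw : Measure (Feat p)) (εLaw : Measure ℝ) :
    Measure (Feat p × ℝ) :=
  (((gaussianMixture θ m S).prod ξLaw).prod εLaw).map
    (fun w => (w.1.1 + w.1.2, g (inner ℝ θ w.1.1) + w.2))

/-! ### The three mixup procedures -/

/-- Vanilla mixup: all pairs are equally close, so that the partner is uniform. -/
def distVanilla {p : ℕ} (_a _b : Feat p × ℝ) : ℝ := 0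

/-- Mixup with feature similarity: squared distance of the features. -/
noncomputable def distFeat {p : ℕ} (a b : Feat p × ℝ) : ℝ := ‖a.1 - b.1‖ ^ 2

/-- C-Mixup: squared distance of the labels. -/
noncomputable def distLabel {p : ℕ} (a b : Feat p × ℝ) : ℝ := (a.2 - b.2) ^ 2

/-- Unnormalised probability `exp (-d(i,j) / (2 σ²))` that example `i` is mixed with another
example `j`. -/
noncomputable def pairWeight {p N : ℕ} (d : Feat p × ℝ → Feat p × ℝ → ℝ) (σ : ℝ)
    (D : Fin N → Feat p × ℝ) (i j : Fin N) : ℝ :=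
  if j = i then 0 else Real.exp (-(d (D i) (D j)) / (2 * σ ^ 2))

/-- The probability that example `i` is mixed with example `j`. -/
noncomputable def pairProb {p N : ℕ} (d : Feat p × ℝ → Feat p × ℝ → ℝ) (σ : ℝ)
    (D : Fin N → Feat p × ℝ) (i j : Fin N) : ℝ :=
  pairWeight d σ D i j / ∑ l : Fin N, pairWeight d σ D i l

/-- The random choices of a mixup procedure on `N` examples: for every example, the index of its
partner and the interpolation ratio. -/
abbrev Choices (N : ℕ) : Type := Fin N → Fin N × ℝ

/-- The augmented data `(x̃ᵢ, ỹᵢ) = λᵢ (xᵢ, yᵢ) + (1 - λᵢ) (xⱼ, yⱼ)`, where `j` is the partner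
of `i`. -/
noncomputable def mixed {p N : ℕ} (D : Fin N → Feat p × ℝ) (A : Choices N) :
    Fin N → Feat p × ℝ :=
  fun i => (A i).2 • D i + (1 - (A i).2) • D (A i).1

/-- Reference measure on the choices: counting measure for the partners, and the law
`Beta(α, α)` for the interpolation ratios. -/
noncomputable def choicesRef (α : ℝ) (N : ℕ) : Measure (Choices N) :=
  Measure.pi fun _ : Fin N => (Measure.count : Measure (Fin N)).prod (betaMeasure α α)

/-- Conditional density of the choices, given the training data, with respect to the reference
measure: the partners are independent, and that of `i` is `j` with probability `pairProb`. -/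
noncomputable def choicesDensity {p N : ℕ} (d : Feat p × ℝ → Feat p × ℝ → ℝ) (σ : ℝ)
    (D : Fin N → Feat p × ℝ) (A : Choices N) : ℝ≥0∞ :=
  ∏ i : Fin N, ENNReal.ofReal (pairProb d σ D i (A i).1)

/-- A realisation of the experiment: the training data, followed by the choices made by C-Mixup,
by mixup with feature similarity, and by vanilla mixup. -/
abbrev Sample (p N : ℕ) : Type :=
  (Fin N → Feat p × ℝ) × Choices N × Choices N × Choices N

/-- The law of the experiment: `N` i.i.d. training examples of law `P`; given these, the three
procedures run independently, with similarity bandwidths `σy` (labels) and `σx` (features). -/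
noncomputable def sampleLaw {p : ℕ} (P : Measure (Feat p × ℝ)) (α σy σx : ℝ) (N : ℕ) :
    Measure (Sample p N) :=
  ((Measure.pi fun _ : Fin N => P).prod
    ((choicesRef α N).prod ((choicesRef α N).prod (choicesRef α N)))).withDensity
    fun ω => choicesDensity distLabel σy ω.1 ω.2.1 *
      (choicesDensity distFeat σx ω.1 ω.2.2.1 * choicesDensity distVanilla 1 ω.1 ω.2.2.2)

/-! ### Estimation and error -/

/-- `b` minimises the sum of squares `∑ i, (ỹᵢ - x̃ᵢᵀ b)²` over the data set `T`. -/
def IsLeastSquares {p n : ℕ} (T : Fin n → Feat p × ℝ) (b : Feat p) : Prop :=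
  ∀ b' : Feat p, ∑ i, ((T i).2 - inner ℝ b (T i).1) ^ 2 ≤ ∑ i, ((T i).2 - inner ℝ b' (T i).1) ^ 2

/-- A (nonnegative, symmetric, normalised) kernel of nonparametric estimation. -/
structure IsSmoothingKernel (κ : ℝ → ℝ) : Prop where
  measurable : Measurable κ
  nonneg : ∀ u, 0 ≤ κ u
  even : ∀ u, κ (-u) = κ u
  integrable : Integrable κ
  integral_eq_one : ∫ u, κ u = 1

/-- The kernel regression estimator
`ĝ(t; b) = ∑ i, κ((bᵀ x̃ᵢ - t) / h) ỹᵢ / ∑ i, κ((bᵀ x̃ᵢ - t) / h)` built on the data set `T`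
(with the usual convention that it is `0` where the denominator vanishes). -/
noncomputable def kernelEstimator {p n : ℕ} (κ : ℝ → ℝ) (h : ℝ) (T : Fin n → Feat p × ℝ)
    (b : Feat p) (t : ℝ) : ℝ :=
  (∑ i, κ ((inner ℝ b (T i).1 - t) / h) * (T i).2) / ∑ i, κ ((inner ℝ b (T i).1 - t) / h)

/-- `MSE(b) = E[(y - ĝ(bᵀ x; b))²]` for a fresh observation `(x, y)` of law `P`, with `ĝ` built on
the data set `T`; an extended nonnegative number. -/
noncomputable def mse {p n : ℕ} (P : Measure (Feat p × ℝ)) (κ : ℝ → ℝ) (h : ℝ)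
    (T : Fin n → Feat p × ℝ) (b : Feat p) : ℝ≥0∞ :=
  ∫⁻ w, ENNReal.ofReal ((w.2 - kernelEstimator κ h T b (inner ℝ b w.1)) ^ 2) ∂P

/-- C-Mixup has strictly smaller error than both other procedures, whichever least squares
solutions are used. -/
def CMixupWins {p N : ℕ} (P : Measure (Feat p × ℝ)) (κ : ℝ → ℝ) (h : ℝ) (ω : Sample p N) : Prop :=
  ∀ bC bF bV : Feat p,
    IsLeastSquares (mixed ω.1 ω.2.1) bC →
    IsLeastSquares (mixed ω.1 ω.2.2.1) bF →
    IsLeastSquares (mixed ω.1 ω.2.2.2) bV →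
    mse P κ h (mixed ω.1 ω.2.1) bC <
      min (mse P κ h (mixed ω.1 ω.2.2.1) bF) (mse P κ h (mixed ω.1 ω.2.2.2) bV)

end CMixup

/-!
The mixture is chosen with two components: centres `0` and `M • θ / ‖θ‖`, standard deviation `1`
along `θ` and `M ^ 2` across it. The kernel is the box kernel, with bandwidth half the label `H` of
the far cluster. The scale `M` is at our disposal for every `N`, so it is enough to show that for
fixed `N` the probability of a failure is eventually, as `M → ∞`, at most a bound that does not
depend on the model and tends to `0` with `N`.

Put `u = θ / ‖θ‖`, divide the features by `M` along `u` and by `M ^ 2` across `u`, and the labels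
by `H`. Least squares, the kernel estimator and the error are equivariant under this normalisation.
As `M → ∞` an observation from the cluster at position `k ∈ {0, 1}` tends to
`(k • u + Gaussian noise across u, k)` (`tendsto_normObs`), because `g` grows at least linearly and
is Lipschitz; the measurement error and the label noise disappear. The limiting data set, and
every data set mixed from it, is fitted exactly by `u`. So if the mixed design has full rank, which
holds almost surely once the far cluster is hit, since the determinant of the Gram matrix is a
non-zero analytic function of the noise and of the ratios (`ae_ne_zero_of_analytic_lines`), then
all least squares solutions tend to `u` (`tendsto_of_isLeastSquares`), and the errors converge as
well (`tendsto_mse`).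

Whether the limiting error vanishes depends on the pairs that were mixed. If both clusters are hit and every
partner belongs to the same cluster, the estimator reproduces the label of the cluster and the
error is `0` (`mse_limit_eq_zero`). If some pair crosses the clusters, with a ratio other than
`0`, `1 / 2` and `1`, then an intermediate label falls into the window of a cluster and the error is
positive (`mse_limit_pos`). For C-Mixup the weight of a crossing pair vanishes in the limit
unless a point is alone in its cluster (`tendsto_choicesDensity_label`). Feature similarity only sees the noise across `u`, which is of
larger order than `M`, and picks the nearest neighbour there (`tendsto_choicesDensity_feat`), and
vanilla mixup picks uniformly; in both cases the partners are independent of the clusters in the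
limit. For a fixed map without fixed points from the sample to itself, few of the `2 ^ N`
assignments of clusters keep each point and its partner together (`card_invariant_le`), which gives
a bound of order `1 / N` for the probability that no pair crosses.

The failure set is not known to be measurable, as it quantifies over all least squares
solutions. It is covered by the measurable `failureEvent`, where the solution is the explicit
`lsSol`, and degenerate designs are included. The convergence of its probability then is dominated
convergence: all the laws of the choices have densities at most `1` with respect to one reference
measure (`eventually_sampleLaw_failure_le`).
-/

namespace CMixup

/-! ### Scaling along and across a direction -/

/-- The operator multiplying by `a` along `u` and by `c` orthogonally to `u` (for a unit
vector `u`). -/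
noncomputable def stretch {p : ℕ} (u : Feat p) (a c : ℝ) : Feat p →L[ℝ] Feat p :=
  c • ContinuousLinearMap.id ℝ (Feat p) + (a - c) • (innerSL ℝ u).smulRight u

lemma stretch_apply {p : ℕ} (u : Feat p) (a c : ℝ) (x : Feat p) :
    stretch u a c x = c • x + ((a - c) * inner ℝ u x) • u := by
  simp [stretch, smul_smul]

lemma inner_stretch {p : ℕ} (u : Feat p) (a c : ℝ) (x y : Feat p) :
    inner ℝ x (stretch u a c y) = inner ℝ (stretch u a c x) y := by
  simp only [stretch_apply, inner_add_left, inner_add_right, real_inner_smul_left,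
    real_inner_smul_right, real_inner_comm x u]
  ring

lemma inner_direction_stretch {p : ℕ} {u : Feat p} (hu : ‖u‖ = 1) (a c : ℝ) (x : Feat p) :
    inner ℝ u (stretch u a c x) = a * inner ℝ u x := by
  simp only [stretch_apply, inner_add_right, real_inner_smul_right, real_inner_self_eq_norm_sq, hu]
  ring

lemma stretch_direction {p : ℕ} {u : Feat p} (hu : ‖u‖ = 1) (a c : ℝ) :
    stretch u a c u = a • u := by
  simp only [stretch_apply, real_inner_self_eq_norm_sq, hu, ← add_smul]
  congr 1; ring

lemma stretch_stretch {p : ℕ} {u : Feat p} (hu : ‖u‖ = 1) (a c a' c' : ℝ) (x : Feat p) :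
    stretch u a c (stretch u a' c' x) = stretch u (a * a') (c * c') x := by
  rw [stretch_apply, inner_direction_stretch hu, stretch_apply, stretch_apply, smul_add, smul_smul,
    smul_smul, add_assoc, ← add_smul]
  congr 2; ring

lemma stretch_one_one {p : ℕ} (u : Feat p) (x : Feat p) : stretch u 1 1 x = x := by
  simp [stretch_apply]

lemma inner_stretch_self {p : ℕ} {u : Feat p} (hu : ‖u‖ = 1) (a c : ℝ) (x : Feat p) :
    inner ℝ x (stretch u a c x)
      = a * inner ℝ u x ^ 2 + c * ‖x - inner ℝ u x • u‖ ^ 2 := by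
  rw [stretch_apply, @norm_sub_sq_real]
  simp only [inner_add_right, real_inner_smul_right, real_inner_self_eq_norm_sq, norm_smul, hu,
    real_inner_comm u x, Real.norm_eq_abs, mul_one, sq_abs]
  ring

/-! ### The Gaussian mixture as an image of a standard Gaussian vector -/

/-- The covariance matrix with eigenvalue `a` on the line of `u` and `c` on its orthogonal
complement. -/
noncomputable def stretchMatrix {p : ℕ} (u : Feat p) (a c : ℝ) : Matrix (Fin p) (Fin p) ℝ :=
  (Matrix.toEuclideanCLM (n := Fin p) (𝕜 := ℝ)).symm (stretch u a c)

lemma toEuclideanCLM_stretchMatrix {p : ℕ} (u : Feat p) (a c : ℝ) :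
    Matrix.toEuclideanCLM (n := Fin p) (𝕜 := ℝ) (stretchMatrix u a c) = stretch u a c := by
  simp [stretchMatrix]

lemma stretchMatrix_isHermitian {p : ℕ} (u : Feat p) (a c : ℝ) :
    (stretchMatrix u a c).IsHermitian := by
  have h : IsSelfAdjoint (stretch u a c) := by
    rw [ContinuousLinearMap.isSelfAdjoint_iff_isSymmetric]
    intro x y
    exact (inner_stretch u a c x y).symm
  have key : star (stretchMatrix u a c) = stretchMatrix u a c := by
    apply (Matrix.toEuclideanCLM (n := Fin p) (𝕜 := ℝ)).toEquiv.injective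
    change Matrix.toEuclideanCLM (n := Fin p) (𝕜 := ℝ) (star (stretchMatrix u a c))
      = Matrix.toEuclideanCLM (n := Fin p) (𝕜 := ℝ) (stretchMatrix u a c)
    rw [map_star, toEuclideanCLM_stretchMatrix]
    exact h
  exact key

lemma stretchMatrix_posDef {p : ℕ} {u : Feat p} (hu : ‖u‖ = 1) {a c : ℝ} (ha : 0 < a)
    (hc : 0 < c) : (stretchMatrix u a c).PosDef := by
  refine Matrix.PosDef.of_dotProduct_mulVec_pos (stretchMatrix_isHermitian u a c) fun v hv => ?_
  have h := Matrix.inner_toEuclideanCLM (stretchMatrix u a c) (WithLp.toLp 2 v)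
    (WithLp.toLp 2 v)
  rw [toEuclideanCLM_stretchMatrix, inner_stretch_self hu] at h
  rw [star_trivial]
  refine lt_of_lt_of_eq ?_ h
  by_cases h0 : inner ℝ u (WithLp.toLp 2 v) = 0
  · have : (WithLp.toLp 2 v : Feat p) ≠ 0 := by simpa using hv
    rw [h0]
    have : 0 < ‖(WithLp.toLp 2 v : Feat p)‖ := norm_pos_iff.2 this
    simp only [zero_smul, sub_zero]
    positivity
  · positivity

open scoped MatrixOrder in
lemma sqrt_stretchMatrix {p : ℕ} {u : Feat p} (hu : ‖u‖ = 1) {c : ℝ} (hc : 0 < c) :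
    CFC.sqrt (stretchMatrix u 1 (c ^ 2)) = stretchMatrix u 1 c := by
  refine CFC.sqrt_unique ?_ (stretchMatrix_posDef hu one_pos hc).posSemidef.nonneg
  apply (Matrix.toEuclideanCLM (n := Fin p) (𝕜 := ℝ)).toEquiv.injective
  change Matrix.toEuclideanCLM (n := Fin p) (𝕜 := ℝ) (_ * _)
      = Matrix.toEuclideanCLM (n := Fin p) (𝕜 := ℝ) _
  rw [map_mul, toEuclideanCLM_stretchMatrix, toEuclideanCLM_stretchMatrix]
  ext1 x
  change stretch u 1 c (stretch u 1 c x) = _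
  rw [stretch_stretch hu, one_mul, pow_two]

/-- The law of the label of a cluster: uniform on the two clusters. -/
noncomputable def clusterLaw : Measure (Fin 2) := (2 : ℝ≥0∞)⁻¹ • Measure.count

instance : IsProbabilityMeasure clusterLaw where
  measure_univ := by
    simp [clusterLaw, Measure.count_univ, ENat.card_eq_coe_fintype_card]
    exact ENNReal.inv_mul_cancel (by simp) (by simp)

lemma gaussianMixture_eq_map {p : ℕ} {θ : Feat p} (hθ : θ ≠ 0) (m : Fin 2 → ℝ) {c : ℝ}
    (hc : 0 < c) :
    gaussianMixture θ m (stretchMatrix (‖θ‖⁻¹ • θ) 1 (c ^ 2))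
      = (clusterLaw.prod (stdGaussian (Feat p))).map
        (fun q => m q.1 • (‖θ‖⁻¹ • θ) + stretch (‖θ‖⁻¹ • θ) 1 c q.2) := by
  have hu : ‖‖θ‖⁻¹ • θ‖ = 1 := norm_smul_inv_norm (𝕜 := ℝ) hθ
  have hmeas : Measurable (fun q : Fin 2 × Feat p =>
      m q.1 • (‖θ‖⁻¹ • θ) + stretch (‖θ‖⁻¹ • θ) 1 c q.2) := by
    have : Measurable m := measurable_of_finite m
    fun_prop
  ext s hs
  rw [Measure.map_apply hmeas hs, Measure.prod_apply (hmeas hs), gaussianMixture, clusterLaw,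
    lintegral_smul_measure, lintegral_count, tsum_fintype]
  simp only [Measure.smul_apply, Measure.finsetSum_apply, smul_eq_mul, Nat.cast_ofNat]
  congr 1
  refine Finset.sum_congr rfl fun k _ => ?_
  rw [multivariateGaussian, sqrt_stretchMatrix hu hc, toEuclideanCLM_stretchMatrix,
    Measure.map_apply (by fun_prop) hs]
  congr 1
  ext w
  simp [div_eq_mul_inv, mul_smul]

/-! ### The scaled model and its limit -/

/-- The unscaled sources of randomness of an observation, apart from its cluster: the standard
Gaussian vector `w` behind `z`, the measurement error `ξ` and the label noise `ε`. -/
abbrev Latent (p : ℕ) : Type := Feat p × Feat p × ℝ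

/-- The law of the latent variables. -/
noncomputable def latentLaw {p : ℕ} (ξLaw : Measure (Feat p)) (εLaw : Measure ℝ) :
    Measure (Latent p) :=
  (stdGaussian (Feat p)).prod (ξLaw.prod εLaw)

instance {p : ℕ} (ξLaw : Measure (Feat p)) (εLaw : Measure ℝ) [IsProbabilityMeasure ξLaw]
    [IsProbabilityMeasure εLaw] : IsProbabilityMeasure (latentLaw ξLaw εLaw) := by
  unfold latentLaw; infer_instance

/-- The position `0` or `1` of a cluster, in the unit of the distance between the clusters. -/
def lab (k : Fin 2) : ℝ := (k : ℕ)

lemma lab_eq_zero_or_one (k : Fin 2) : lab k = 0 ∨ lab k = 1 := by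
  fin_cases k <;> simp [lab]

lemma lab_injective : Function.Injective lab := fun a b h => by
  simpa [lab, Fin.ext_iff] using h

/-- The distance between the two clusters at stage `n`, where `n → ∞` for a fixed sample size. -/
def scale (n : ℕ) : ℝ := n + 1

lemma scale_pos (n : ℕ) : 0 < scale n := by unfold scale; positivity

lemma tendsto_scale : Tendsto scale atTop atTop :=
  tendsto_atTop_add_const_right _ _ tendsto_natCast_atTop_atTop

lemma tendsto_scale_inv : Tendsto (fun n => (scale n)⁻¹) atTop (𝓝 0) :=
  tendsto_scale.inv_tendsto_atTop

/-- The value of `z` at stage `n`: standard deviation `1` along `u`, and the square of the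
distance between the clusters across `u`. The noise across `u` thus dominates the distance between
the clusters, so that nearest neighbours do not reveal the clusters. -/
noncomputable def signal {p : ℕ} (u : Feat p) (n : ℕ) (q : Fin 2 × Latent p) : Feat p :=
  (scale n * lab q.1) • u + stretch u 1 (scale n ^ 2) q.2.1

/-- The observation at stage `n`, as a function of the cluster and of the latent variables. -/
noncomputable def rawObs {p : ℕ} (g : ℝ → ℝ) (θ : Feat p) (n : ℕ) (q : Fin 2 × Latent p) :
    Feat p × ℝ :=
  (signal (‖θ‖⁻¹ • θ) n q + q.2.2.1, g (inner ℝ θ (signal (‖θ‖⁻¹ • θ) n q)) + q.2.2.2)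

@[fun_prop]
lemma measurable_lab : Measurable lab := measurable_of_finite lab

@[fun_prop]
lemma measurable_signal {p : ℕ} (u : Feat p) (n : ℕ) : Measurable (signal u n) := by
  unfold signal; fun_prop

@[fun_prop]
lemma measurable_rawObs {p : ℕ} {g : ℝ → ℝ} (hg : Measurable g) (θ : Feat p) (n : ℕ) :
    Measurable (rawObs g θ n) := by
  unfold rawObs; fun_prop

lemma obsLaw_eq_map {p : ℕ} {g : ℝ → ℝ} (hg : Measurable g) {θ : Feat p} (hθ : θ ≠ 0) (n : ℕ)
    (ξLaw : Measure (Feat p)) (εLaw : Measure ℝ) [IsProbabilityMeasure ξLaw]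
    [IsProbabilityMeasure εLaw] :
    obsLaw g θ (fun k => scale n * lab k) (stretchMatrix (‖θ‖⁻¹ • θ) 1 ((scale n ^ 2) ^ 2))
        ξLaw εLaw
      = (clusterLaw.prod (latentLaw ξLaw εLaw)).map (rawObs g θ n) := by
  have hs : 0 < scale n ^ 2 := pow_pos (scale_pos n) 2
  have hm : Measurable (fun q : Fin 2 × Feat p =>
      (scale n * lab q.1) • (‖θ‖⁻¹ • θ) + stretch (‖θ‖⁻¹ • θ) 1 (scale n ^ 2) q.2) := by
    fun_prop
  rw [obsLaw, gaussianMixture_eq_map hθ (fun k => scale n * lab k) hs]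
  have e1 : ((clusterLaw.prod (stdGaussian (Feat p))).map (fun q : Fin 2 × Feat p =>
      (scale n * lab q.1) • (‖θ‖⁻¹ • θ) + stretch (‖θ‖⁻¹ • θ) 1 (scale n ^ 2) q.2)).prod ξLaw
      = ((clusterLaw.prod (stdGaussian (Feat p))).prod ξLaw).map
        (Prod.map (fun q : Fin 2 × Feat p =>
      (scale n * lab q.1) • (‖θ‖⁻¹ • θ) + stretch (‖θ‖⁻¹ • θ) 1 (scale n ^ 2) q.2) id) := by
    conv_lhs => rw [← Measure.map_id (μ := ξLaw)]
    exact Measure.map_prod_map _ _ hm measurable_id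
  have e2 : ∀ ν : Measure ((Fin 2 × Feat p) × Feat p), SFinite ν →
      (ν.map (Prod.map (fun q : Fin 2 × Feat p =>
      (scale n * lab q.1) • (‖θ‖⁻¹ • θ) + stretch (‖θ‖⁻¹ • θ) 1 (scale n ^ 2) q.2) id)).prod εLaw
      = (ν.prod εLaw).map (Prod.map (Prod.map (fun q : Fin 2 × Feat p =>
      (scale n * lab q.1) • (‖θ‖⁻¹ • θ) + stretch (‖θ‖⁻¹ • θ) 1 (scale n ^ 2) q.2) id) id) := by
    intro ν hν
    conv_lhs => rw [← Measure.map_id (μ := εLaw)]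
    exact Measure.map_prod_map _ _ (hm.prodMap measurable_id) measurable_id
  have e3 : clusterLaw.prod (latentLaw ξLaw εLaw)
      = (((clusterLaw.prod (stdGaussian (Feat p))).prod ξLaw).prod εLaw).map
        (fun w => (w.1.1.1, (w.1.1.2, (w.1.2, w.2)))) := by
    have a := Measure.prodAssoc_prod (μ := clusterLaw) (ν := stdGaussian (Feat p))
      (τ := ξLaw.prod εLaw)
    have b := Measure.prodAssoc_prod (μ := clusterLaw.prod (stdGaussian (Feat p))) (ν := ξLaw)
      (τ := εLaw)
    rw [latentLaw, ← a, ← b, Measure.map_map (by fun_prop) (by fun_prop)]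
    rfl
  rw [e1, e2 _ inferInstance, e3, Measure.map_map (by fun_prop) (by fun_prop),
    Measure.map_map (by fun_prop) (by fun_prop)]
  rfl

/-- Division of the features by the distance between the clusters along `u` and by its square
across `u`, and of the label by `H`. -/
noncomputable def normObs {p : ℕ} (u : Feat p) (n : ℕ) (H : ℝ) (a : Feat p × ℝ) : Feat p × ℝ :=
  (stretch u (scale n)⁻¹ (scale n ^ 2)⁻¹ a.1, a.2 / H)

/-- The limit of a normalised observation: the cluster centre plus Gaussian noise across `u`, with
the label equal to the position of the cluster. -/
noncomputable def limObs {p : ℕ} (u : Feat p) (k : Fin 2) (w : Feat p) : Feat p × ℝ :=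
  (lab k • u + stretch u 0 1 w, lab k)

/-- The unit of the labels at stage `n`: the label of the far cluster (truncated from below, to
be positive for all `n`). -/
noncomputable def labelUnit {p : ℕ} (g : ℝ → ℝ) (θ : Feat p) (n : ℕ) : ℝ :=
  max 1 (g (‖θ‖ * scale n))

lemma labelUnit_pos {p : ℕ} (g : ℝ → ℝ) (θ : Feat p) (n : ℕ) : 0 < labelUnit g θ n :=
  lt_of_lt_of_le one_pos (le_max_left _ _)

/-- The consequences of `c₀ < g' < c₁` that matter: `g` is Lipschitz and grows at least
linearly. -/
structure IsLink (g : ℝ → ℝ) (c₀ c₁ : ℝ) : Prop where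
  pos : 0 < c₀
  measurable : Measurable g
  lipschitz : ∀ s t, |g s - g t| ≤ c₁ * |s - t|
  growth : ∀ s t, s ≤ t → c₀ * (t - s) ≤ g t - g s

lemma isLink_of_deriv {g : ℝ → ℝ} {c₀ c₁ : ℝ} (hc₀ : 0 < c₀) (hg : ContDiff ℝ 1 g)
    (hg' : ∀ t, c₀ < deriv g t ∧ deriv g t < c₁) : IsLink g c₀ c₁ where
  pos := hc₀
  measurable := hg.continuous.measurable
  lipschitz s t := by
    have := Convex.norm_image_sub_le_of_norm_deriv_le (f := g) (C := c₁) (s := Set.univ) (x := t)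
      (y := s) (fun x _ => hg.differentiable one_ne_zero x)
      (fun x _ => by
        rw [Real.norm_eq_abs, abs_of_pos (hc₀.trans (hg' x).1)]; exact (hg' x).2.le)
      convex_univ (Set.mem_univ _) (Set.mem_univ _)
    simpa [Real.norm_eq_abs] using this
  growth s t h := mul_sub_le_image_sub_of_le_deriv (hg.differentiable one_ne_zero)
    (fun x => (hg' x).1.le) h

section Limits

variable {p : ℕ} {g : ℝ → ℝ} {c₀ c₁ : ℝ} {θ : Feat p}

lemma inner_signal (hθ : θ ≠ 0) (n : ℕ) (q : Fin 2 × Latent p) :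
    inner ℝ θ (signal (‖θ‖⁻¹ • θ) n q)
      = ‖θ‖ * (scale n * lab q.1) + ‖θ‖ * inner ℝ (‖θ‖⁻¹ • θ) q.2.1 := by
  have hu : ‖‖θ‖⁻¹ • θ‖ = 1 := norm_smul_inv_norm (𝕜 := ℝ) hθ
  have h0 : ‖θ‖ ≠ 0 := norm_ne_zero_iff.2 hθ
  have h1 : ∀ x, inner ℝ θ x = ‖θ‖ * inner ℝ (‖θ‖⁻¹ • θ) x := fun x => by
    rw [real_inner_smul_left]; field_simp
  rw [h1, signal, inner_add_right, inner_direction_stretch hu, real_inner_smul_right,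
    real_inner_self_eq_norm_sq, hu]
  ring

lemma tendsto_link_scale (hg : IsLink g c₀ c₁) (hθ : θ ≠ 0) :
    Tendsto (fun n => g (‖θ‖ * scale n)) atTop atTop := by
  have h0 : 0 < ‖θ‖ := norm_pos_iff.2 hθ
  refine tendsto_atTop_mono (f := fun n => g 0 + (c₀ * ‖θ‖) * scale n) (fun n => ?_)
    (tendsto_atTop_add_const_left _ _ (tendsto_scale.const_mul_atTop (mul_pos hg.pos h0)))
  have := hg.growth 0 (‖θ‖ * scale n) (mul_nonneg h0.le (scale_pos n).le)
  linarith

lemma tendsto_labelUnit (hg : IsLink g c₀ c₁) (hθ : θ ≠ 0) :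
    Tendsto (labelUnit g θ) atTop atTop :=
  tendsto_atTop_mono (fun _ => le_max_right _ _) (tendsto_link_scale hg hθ)

lemma abs_link_signal_sub_le (hg : IsLink g c₀ c₁) (hθ : θ ≠ 0) (n : ℕ) (q : Fin 2 × Latent p) :
    |g (inner ℝ θ (signal (‖θ‖⁻¹ • θ) n q)) - g (‖θ‖ * (scale n * lab q.1))|
      ≤ c₁ * (‖θ‖ * |inner ℝ (‖θ‖⁻¹ • θ) q.2.1|) := by
  refine (hg.lipschitz _ _).trans_eq ?_
  rw [inner_signal hθ, add_sub_cancel_left, abs_mul, abs_norm]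

lemma tendsto_link_center (hg : IsLink g c₀ c₁) (hθ : θ ≠ 0) (k : Fin 2) :
    Tendsto (fun n => g (‖θ‖ * (scale n * lab k)) / labelUnit g θ n) atTop (𝓝 (lab k)) := by
  rcases lab_eq_zero_or_one k with h | h
  · simp only [h, mul_zero]
    exact tendsto_const_nhds.div_atTop (tendsto_labelUnit hg hθ)
  · simp only [h, mul_one]
    refine tendsto_const_nhds.congr' ?_
    filter_upwards [(tendsto_link_scale hg hθ).eventually_ge_atTop 1] with n hn
    rw [labelUnit, max_eq_right hn, div_self (by linarith)]

lemma tendsto_normObs (hg : IsLink g c₀ c₁) (hθ : θ ≠ 0) (q : Fin 2 × Latent p) :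
    Tendsto (fun n => normObs (‖θ‖⁻¹ • θ) n (labelUnit g θ n) (rawObs g θ n q)) atTop
      (𝓝 (limObs (‖θ‖⁻¹ • θ) q.1 q.2.1)) := by
  have hu : ‖‖θ‖⁻¹ • θ‖ = 1 := norm_smul_inv_norm (𝕜 := ℝ) hθ
  refine Tendsto.prodMk_nhds ?_ ?_
  · set u := ‖θ‖⁻¹ • θ
    have hs : ∀ n, scale n ≠ 0 := fun n => (scale_pos n).ne'
    have e : ∀ n, stretch u (scale n)⁻¹ (scale n ^ 2)⁻¹ (rawObs g θ n q).1
        = (lab q.1 • u + stretch u (scale n)⁻¹ 1 q.2.1)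
          + stretch u (scale n)⁻¹ (scale n ^ 2)⁻¹ q.2.2.1 := fun n => by
      simp only [rawObs, signal, map_add]
      rw [ContinuousLinearMap.map_smul, stretch_stretch hu, stretch_direction hu, smul_smul, mul_one,
        inv_mul_cancel₀ (pow_ne_zero 2 (hs n)), mul_right_comm, mul_inv_cancel₀ (hs n), one_mul]
    simp only [e]
    have h2 : Tendsto (fun n => (scale n ^ 2)⁻¹) atTop (𝓝 0) := by
      simpa using tendsto_scale_inv.pow 2
    have key : ∀ (c : ℕ → ℝ) (c' : ℝ) (x : Feat p), Tendsto c atTop (𝓝 c') →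
        Tendsto (fun n => stretch u (scale n)⁻¹ (c n) x) atTop (𝓝 (stretch u 0 c' x)) := by
      intro c c' x hc
      simp only [stretch_apply]
      exact (hc.smul_const x).add
        (((tendsto_scale_inv.sub hc).mul_const _).smul_const u)
    have h3 : stretch u 0 0 q.2.2.1 = 0 := by simp [stretch_apply]
    have := (tendsto_const_nhds (x := lab q.1 • u)).add (key _ 1 q.2.1 tendsto_const_nhds) |>.add
      (key _ 0 q.2.2.1 h2)
    simpa [h3] using this
  · have hb : Tendsto (fun n => (rawObs g θ n q).2 / labelUnit g θ n
        - g (‖θ‖ * (scale n * lab q.1)) / labelUnit g θ n) atTop (𝓝 0) := by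
      refine squeeze_zero_norm (a := fun n =>
        (c₁ * (‖θ‖ * |inner ℝ (‖θ‖⁻¹ • θ) q.2.1|) + |q.2.2.2|) / labelUnit g θ n) (fun n => ?_)
        (tendsto_const_nhds.div_atTop (tendsto_labelUnit hg hθ))
      rw [← sub_div, norm_div, Real.norm_eq_abs, Real.norm_eq_abs,
        abs_of_pos (labelUnit_pos g θ n)]
      refine div_le_div_of_nonneg_right ?_ (labelUnit_pos g θ n).le
      have := abs_link_signal_sub_le hg hθ n q
      simp only [rawObs]
      rw [add_sub_right_comm]
      exact (abs_add_le _ _).trans (add_le_add_left this _)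
    simpa using hb.add (tendsto_link_center hg hθ q.1)

/-- A bound, uniform in the stage, on the normalised label. -/
lemma abs_normObs_snd_le (hg : IsLink g c₀ c₁) (hθ : θ ≠ 0) (n : ℕ) (q : Fin 2 × Latent p) :
    |(normObs (‖θ‖⁻¹ • θ) n (labelUnit g θ n) (rawObs g θ n q)).2|
      ≤ |g 0| + 1 + c₁ * (‖θ‖ * |inner ℝ (‖θ‖⁻¹ • θ) q.2.1|) + |q.2.2.2| := by
  have hH := labelUnit_pos g θ n
  have h1 : 1 ≤ labelUnit g θ n := le_max_left _ _
  have hc : |g (‖θ‖ * (scale n * lab q.1))| ≤ |g 0| + labelUnit g θ n := by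
    rcases lab_eq_zero_or_one q.1 with h | h
    · simp only [h, mul_zero]; linarith
    · simp only [h, mul_one]
      have hs : 0 ≤ ‖θ‖ * scale n := mul_nonneg (norm_nonneg _) (scale_pos n).le
      have h3 := hg.growth 0 _ hs
      have h4 : g (‖θ‖ * scale n) ≤ labelUnit g θ n := le_max_right _ _
      have h5 : 0 ≤ c₀ * (‖θ‖ * scale n - 0) := by
        rw [sub_zero]; exact mul_nonneg hg.pos.le hs
      have := neg_abs_le (g 0)
      have := abs_nonneg (g 0)
      rw [abs_le]; constructor <;> linarith
  have h2 := abs_link_signal_sub_le hg hθ n q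
  have hB : 0 ≤ c₁ * (‖θ‖ * |inner ℝ (‖θ‖⁻¹ • θ) q.2.1|) := (abs_nonneg _).trans h2
  simp only [normObs, rawObs]
  rw [abs_div, abs_of_pos hH, div_le_iff₀ hH]
  set t := g (inner ℝ θ (signal (‖θ‖⁻¹ • θ) n q))
  have h6 : |t + q.2.2.2| ≤ |t - g (‖θ‖ * (scale n * lab q.1))|
      + |g (‖θ‖ * (scale n * lab q.1))| + |q.2.2.2| := by
    refine (abs_add_le _ _).trans (add_le_add_left ?_ _)
    simpa using abs_add_le (t - g (‖θ‖ * (scale n * lab q.1))) (g (‖θ‖ * (scale n * lab q.1)))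
  have := abs_nonneg (g 0)
  have := abs_nonneg q.2.2.2
  nlinarith [mul_nonneg (abs_nonneg (g 0)) (sub_nonneg.2 h1), mul_nonneg hB (sub_nonneg.2 h1),
    mul_nonneg (abs_nonneg q.2.2.2) (sub_nonneg.2 h1)]

end Limits

/-! ### The box kernel and invariance under normalisation -/

/-- The uniform kernel on `[-1, 1]`. -/
noncomputable def boxKernel (v : ℝ) : ℝ := if |v| ≤ 1 then 1 / 2 else 0

@[fun_prop]
lemma measurable_boxKernel : Measurable boxKernel :=
  Measurable.ite (measurableSet_le (by fun_prop) (by fun_prop)) measurable_const measurable_const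

lemma boxKernel_nonneg (v : ℝ) : 0 ≤ boxKernel v := by
  unfold boxKernel; split_ifs <;> norm_num

lemma boxKernel_eq_indicator :
    boxKernel = (Set.Icc (-1 : ℝ) 1).indicator fun _ => (1 / 2 : ℝ) := by
  ext v
  simp only [boxKernel, Set.indicator_apply, Set.mem_Icc, abs_le]

lemma isSmoothingKernel_boxKernel : IsSmoothingKernel boxKernel where
  measurable := measurable_boxKernel
  nonneg := boxKernel_nonneg
  even v := by simp [boxKernel]
  integrable := by
    rw [boxKernel_eq_indicator]
    exact (integrable_indicator_iff measurableSet_Icc).2 (by simp)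
  integral_eq_one := by
    rw [boxKernel_eq_indicator, integral_indicator measurableSet_Icc]
    norm_num

section Normalisation

variable {p N : ℕ} {u : Feat p}

/-- The coefficient vector that plays the role of `b` after normalisation of the data. -/
noncomputable def normCoef (u : Feat p) (n : ℕ) (H : ℝ) (b : Feat p) : Feat p :=
  H⁻¹ • stretch u (scale n) (scale n ^ 2) b

lemma inner_normCoef (hu : ‖u‖ = 1) (n : ℕ) (H : ℝ) (b : Feat p) (a : Feat p × ℝ) :
    inner ℝ (normCoef u n H b) (normObs u n H a).1 = inner ℝ b a.1 / H := by
  have hs : scale n ≠ 0 := (scale_pos n).ne'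
  simp only [normCoef, normObs]
  rw [real_inner_smul_left, ← inner_stretch, stretch_stretch hu, mul_inv_cancel₀ hs,
    mul_inv_cancel₀ (pow_ne_zero 2 hs), stretch_one_one]
  field_simp

lemma exists_normCoef_eq (hu : ‖u‖ = 1) (n : ℕ) {H : ℝ} (hH : 0 < H) (b : Feat p) :
    ∃ b', normCoef u n H b' = b := by
  have hs : scale n ≠ 0 := (scale_pos n).ne'
  refine ⟨H • stretch u (scale n)⁻¹ (scale n ^ 2)⁻¹ b, ?_⟩
  rw [normCoef, map_smul, stretch_stretch hu, mul_inv_cancel₀ hs,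
    mul_inv_cancel₀ (pow_ne_zero 2 hs), stretch_one_one, smul_smul, inv_mul_cancel₀ hH.ne',
    one_smul]

lemma IsLeastSquares.normalise (hu : ‖u‖ = 1) (n : ℕ) {H : ℝ} (hH : 0 < H)
    {T : Fin N → Feat p × ℝ} {b : Feat p} (h : IsLeastSquares T b) :
    IsLeastSquares (fun i => normObs u n H (T i)) (normCoef u n H b) := by
  have key : ∀ c : Feat p, ∑ i, ((normObs u n H (T i)).2
      - inner ℝ (normCoef u n H c) (normObs u n H (T i)).1) ^ 2
      = (∑ i, ((T i).2 - inner ℝ c (T i).1) ^ 2) / H ^ 2 := fun c => by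
    rw [Finset.sum_div]
    refine Finset.sum_congr rfl fun i _ => ?_
    rw [inner_normCoef hu, normObs, ← sub_div, div_pow]
  intro b'
  obtain ⟨c, rfl⟩ := exists_normCoef_eq hu n hH b'
  rw [key, key]
  exact div_le_div_of_nonneg_right (h c) (sq_nonneg H)

lemma kernelEstimator_normalise (hu : ‖u‖ = 1) (n : ℕ) (H : ℝ) (κ : ℝ → ℝ) (h : ℝ)
    (T : Fin N → Feat p × ℝ) (b : Feat p) (t : ℝ) :
    kernelEstimator κ h (fun i => normObs u n H (T i)) (normCoef u n H b) (t / H)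
      = kernelEstimator κ (H * h) T b t / H := by
  simp only [kernelEstimator, inner_normCoef hu]
  have e : ∀ s : ℝ, (s / H - t / H) / h = (s - t) / (H * h) := fun s => by
    rw [← sub_div, div_div]
  simp only [e, normObs]
  rw [div_right_comm]
  congr 1
  rw [Finset.sum_div]
  simp only [mul_div_assoc]

@[fun_prop]
lemma measurable_normObs (u : Feat p) (n : ℕ) (H : ℝ) : Measurable (normObs u n H) := by
  unfold normObs; fun_prop

lemma measurable_kernelEstimator {X : Type*} [MeasurableSpace X] {κ : ℝ → ℝ} (hκ : Measurable κ)
    (h : ℝ) {T : X → Fin N → Feat p × ℝ} {b : X → Feat p} {t : X → ℝ} (hT : Measurable T)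
    (hb : Measurable b) (ht : Measurable t) :
    Measurable (fun x => kernelEstimator κ h (T x) (b x) (t x)) := by
  unfold kernelEstimator
  fun_prop

lemma mse_normalise (hu : ‖u‖ = 1) (n : ℕ) {H : ℝ} (hH : 0 < H) (P : Measure (Feat p × ℝ))
    {κ : ℝ → ℝ} (hκ : Measurable κ) (h : ℝ) (T : Fin N → Feat p × ℝ) (b : Feat p) :
    mse P κ (H * h) T b = ENNReal.ofReal (H ^ 2)
      * mse (P.map (normObs u n H)) κ h (fun i => normObs u n H (T i)) (normCoef u n H b) := by
  have hm : Measurable fun w : Feat p × ℝ => kernelEstimator κ h (fun i => normObs u n H (T i))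
      (normCoef u n H b) (inner ℝ (normCoef u n H b) w.1) :=
    measurable_kernelEstimator hκ h measurable_const measurable_const (by fun_prop)
  have hm' : Measurable fun w : Feat p × ℝ => ENNReal.ofReal ((w.2 - kernelEstimator κ h
      (fun i => normObs u n H (T i))
      (normCoef u n H b) (inner ℝ (normCoef u n H b) w.1)) ^ 2) := by fun_prop
  rw [mse, mse, lintegral_map hm' (by fun_prop), ← lintegral_const_mul' _ _ ENNReal.ofReal_ne_top]
  refine lintegral_congr fun w => ?_
  rw [inner_normCoef hu, kernelEstimator_normalise hu n H, ← ENNReal.ofReal_mul (sq_nonneg _),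
    ← mul_pow]
  congr 2
  simp only [normObs]
  field_simp

lemma mixed_normObs (u : Feat p) (n : ℕ) (H : ℝ) (D : Fin N → Feat p × ℝ) (A : Choices N) :
    mixed (fun i => normObs u n H (D i)) A = fun i => normObs u n H (mixed D A i) := by
  funext i
  simp only [mixed, normObs]
  ext1
  · simp
  · simp [mul_div_assoc, add_div]

end Normalisation

/-! ### Stability of least squares at an exact fit -/

section LeastSquares

variable {p N : ℕ}

/-- The features of the data set span the feature space, so that the least squares problem has a
unique solution. -/
def FullRank (T : Fin N → Feat p × ℝ) : Prop :=
  ∀ c : Feat p, (∀ i, inner ℝ c (T i).1 = 0) → c = 0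

lemma FullRank.exists_norm_le {T : Fin N → Feat p × ℝ} (h : FullRank T) :
    ∃ K : ℝ, 0 < K ∧ ∀ (c : Feat p) (C : ℝ), 0 ≤ C → (∀ i, |inner ℝ c (T i).1| ≤ C) →
      ‖c‖ ≤ K * C := by
  let f : Feat p →ₗ[ℝ] (Fin N → ℝ) := LinearMap.pi fun i => (innerSL ℝ (T i).1).toLinearMap
  have hf : LinearMap.ker f = ⊥ := by
    rw [LinearMap.ker_eq_bot']
    intro c hc
    refine h c fun i => ?_
    rw [real_inner_comm]
    exact congrFun hc i
  obtain ⟨K, hK, hanti⟩ := f.exists_antilipschitzWith hf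
  refine ⟨K, by exact_mod_cast hK, fun c C hC hc => ?_⟩
  have h1 := hanti.le_mul_dist c 0
  simp only [map_zero, dist_zero_right] at h1
  refine h1.trans (mul_le_mul_of_nonneg_left ?_ K.2)
  refine (pi_norm_le_iff_of_nonneg hC).2 fun i => ?_
  have := hc i
  rw [real_inner_comm] at this
  exact this

lemma FullRank.eventually_norm_le {l : Filter ℕ} {T : ℕ → Fin N → Feat p × ℝ}
    {T' : Fin N → Feat p × ℝ} (h : FullRank T') (hT : Tendsto T l (𝓝 T')) :
    ∃ K : ℝ, 0 < K ∧ ∀ᶠ n in l, ∀ (c : Feat p) (C : ℝ), 0 ≤ C →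
      (∀ i, |inner ℝ c (T n i).1| ≤ C) → ‖c‖ ≤ K * C := by
  obtain ⟨K, hK, hb⟩ := h.exists_norm_le
  refine ⟨2 * K, by positivity, ?_⟩
  have hd : Tendsto (fun n => ∑ i, ‖(T n i).1 - (T' i).1‖) l (𝓝 0) := by
    have : Tendsto (fun n => ∑ i, ‖(T n i).1 - (T' i).1‖) l
        (𝓝 (∑ i : Fin N, ‖(T' i).1 - (T' i).1‖)) :=
      tendsto_finsetSum _ fun i _ => (((tendsto_pi_nhds.1 hT i).fst_nhds).sub_const _).norm
    simpa using this
  filter_upwards [hd.eventually_le_const (show (0 : ℝ) < 1 / (2 * K) by positivity)]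
    with n hn c C hC hc
  have h1 : ∀ i, |inner ℝ c (T' i).1| ≤ C + ‖c‖ * (1 / (2 * K)) := fun i => by
    have e : inner ℝ c (T' i).1 = inner ℝ c (T n i).1 - inner ℝ c ((T n i).1 - (T' i).1) := by
      rw [← inner_sub_right]; simp
    rw [e]
    refine (abs_sub _ _).trans (add_le_add (hc i) ((abs_real_inner_le_norm _ _).trans ?_))
    refine mul_le_mul_of_nonneg_left (le_trans ?_ hn) (norm_nonneg _)
    exact Finset.single_le_sum (f := fun i => ‖(T n i).1 - (T' i).1‖)
      (fun _ _ => norm_nonneg _) (Finset.mem_univ i)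
  have h2 := hb c _ (by positivity) h1
  have h3 : K * (C + ‖c‖ * (1 / (2 * K))) = K * C + ‖c‖ / 2 := by field_simp
  linarith

lemma FullRank.eventually {l : Filter ℕ} {T : ℕ → Fin N → Feat p × ℝ}
    {T' : Fin N → Feat p × ℝ} (h : FullRank T') (hT : Tendsto T l (𝓝 T')) :
    ∀ᶠ n in l, FullRank (T n) := by
  obtain ⟨K, -, hb⟩ := h.eventually_norm_le hT
  filter_upwards [hb] with n hn c hc
  have := hn c 0 le_rfl fun i => by simp [hc i]
  simpa using this

/-- If the limiting data set is fitted exactly by `u`, then least squares solutions tend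
to `u`. -/
lemma tendsto_of_isLeastSquares {l : Filter ℕ} {T : ℕ → Fin N → Feat p × ℝ}
    {T' : Fin N → Feat p × ℝ} (h : FullRank T') (hT : Tendsto T l (𝓝 T')) {u : Feat p}
    (hfit : ∀ i, (T' i).2 = inner ℝ u (T' i).1) {b : ℕ → Feat p}
    (hb : ∀ᶠ n in l, IsLeastSquares (T n) (b n)) : Tendsto b l (𝓝 u) := by
  obtain ⟨K, hK, hbd⟩ := h.eventually_norm_le hT
  set R : ℕ → ℝ := fun n => ∑ i, ((T n i).2 - inner ℝ u (T n i).1) ^ 2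
  have hR : Tendsto R l (𝓝 0) := by
    have : Tendsto R l (𝓝 (∑ i, ((T' i).2 - inner ℝ u (T' i).1) ^ 2)) :=
      tendsto_finsetSum _ fun i _ => (((tendsto_pi_nhds.1 hT i).snd_nhds).sub
        (tendsto_const_nhds.inner (tendsto_pi_nhds.1 hT i).fst_nhds)).pow 2
    simpa [hfit] using this
  have hS : Tendsto (fun n => K * (2 * √(R n))) l (𝓝 0) := by
    simpa using ((Real.continuous_sqrt.tendsto 0).comp hR).const_mul 2 |>.const_mul K
  rw [tendsto_iff_norm_sub_tendsto_zero]
  refine squeeze_zero' (Eventually.of_forall fun _ => norm_nonneg _) ?_ hS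
  filter_upwards [hb, hbd] with n h1 h2
  refine h2 _ _ (by positivity) fun i => ?_
  have term : ∀ c : Feat p, ∑ i, ((T n i).2 - inner ℝ c (T n i).1) ^ 2 ≤ R n →
      |(T n i).2 - inner ℝ c (T n i).1| ≤ √(R n) := fun c hc => by
    refine Real.abs_le_sqrt (le_trans ?_ hc)
    exact Finset.single_le_sum (f := fun i => ((T n i).2 - inner ℝ c (T n i).1) ^ 2)
      (fun _ _ => sq_nonneg _) (Finset.mem_univ i)
  have ha := term (b n) (h1 u)
  have hb' := term u le_rfl
  rw [inner_sub_left, show inner ℝ (b n) (T n i).1 - inner ℝ u (T n i).1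
    = ((T n i).2 - inner ℝ u (T n i).1) - ((T n i).2 - inner ℝ (b n) (T n i).1) by ring]
  refine (abs_sub _ _).trans ?_
  linarith

end LeastSquares

/-! ### Continuity of the estimator and of its error -/

section Continuity

variable {p N : ℕ}

lemma eventually_boxKernel_eq {l : Filter ℕ} {r : ℕ → ℝ} {r' : ℝ} (hr : Tendsto r l (𝓝 r'))
    (h : |r'| ≠ 1) : ∀ᶠ n in l, boxKernel (r n) = boxKernel r' := by
  rcases lt_or_gt_of_ne h with h | h
  · filter_upwards [hr.abs.eventually_lt_const h] with n hn
    simp [boxKernel, hn.le, h.le]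
  · filter_upwards [hr.abs.eventually_const_lt h] with n hn
    simp [boxKernel, hn.not_ge, h.not_ge]

/-- The estimator is continuous where no observation lies on the boundary of the window. -/
lemma tendsto_kernelEstimator {l : Filter ℕ} {T : ℕ → Fin N → Feat p × ℝ}
    {T' : Fin N → Feat p × ℝ} (hT : Tendsto T l (𝓝 T')) {b : ℕ → Feat p} {b' : Feat p}
    (hb : Tendsto b l (𝓝 b')) {t : ℕ → ℝ} {t' : ℝ} (ht : Tendsto t l (𝓝 t'))
    (hties : ∀ i, |inner ℝ b' (T' i).1 - t'| ≠ 1 / 2) :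
    Tendsto (fun n => kernelEstimator boxKernel (1 / 2) (T n) (b n) (t n)) l
      (𝓝 (kernelEstimator boxKernel (1 / 2) T' b' t')) := by
  have hev : ∀ᶠ n in l, ∀ i, boxKernel ((inner ℝ (b n) (T n i).1 - t n) / (1 / 2))
      = boxKernel ((inner ℝ b' (T' i).1 - t') / (1 / 2)) := by
    refine eventually_all.2 fun i => eventually_boxKernel_eq
      (((hb.inner (tendsto_pi_nhds.1 hT i).fst_nhds).sub ht).div_const _) fun h => hties i ?_
    rw [abs_div, abs_of_pos (by norm_num : (0 : ℝ) < 1 / 2)] at h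
    linarith [(div_eq_iff (by norm_num : (1 / 2 : ℝ) ≠ 0)).1 h]
  have hlim : Tendsto (fun n =>
      (∑ i, boxKernel ((inner ℝ b' (T' i).1 - t') / (1 / 2)) * (T n i).2)
        / ∑ i, boxKernel ((inner ℝ b' (T' i).1 - t') / (1 / 2))) l
      (𝓝 (kernelEstimator boxKernel (1 / 2) T' b' t')) :=
    (tendsto_finsetSum _ fun i _ =>
      ((tendsto_pi_nhds.1 hT i).snd_nhds).const_mul _).div_const _
  refine hlim.congr' ?_
  filter_upwards [hev] with n hn
  simp only [kernelEstimator, hn]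

lemma abs_kernelEstimator_le {κ : ℝ → ℝ} (hκ : ∀ v, 0 ≤ κ v) (h : ℝ) (T : Fin N → Feat p × ℝ)
    (b : Feat p) (t : ℝ) : |kernelEstimator κ h T b t| ≤ ∑ i, |(T i).2| := by
  set k : Fin N → ℝ := fun i => κ ((inner ℝ b (T i).1 - t) / h)
  have hk : ∀ i, 0 ≤ k i := fun i => hκ _
  have hsum : 0 ≤ ∑ i, k i := Finset.sum_nonneg fun i _ => hk i
  change |(∑ i, k i * (T i).2) / ∑ i, k i| ≤ _
  rw [abs_div, abs_of_nonneg hsum]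
  refine div_le_of_le_mul₀ hsum (Finset.sum_nonneg fun i _ => abs_nonneg _) ?_
  rw [Finset.sum_mul]
  refine (Finset.abs_sum_le_sum_abs _ _).trans ?_
  refine Finset.sum_le_sum fun i _ => ?_
  rw [abs_mul, abs_of_nonneg (hk i), mul_comm]
  exact mul_le_mul_of_nonneg_left
    (Finset.single_le_sum (fun j _ => hk j) (Finset.mem_univ i)) (abs_nonneg _)

/-- Convergence of the errors, by dominated convergence over the fresh observation. -/
lemma tendsto_mse {X : Type*} [MeasurableSpace X] {ν : Measure X} [IsFiniteMeasure ν]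
    {φ : ℕ → X → Feat p × ℝ} {φ' : X → Feat p × ℝ}
    (hφ : ∀ n, Measurable (φ n)) (hφ' : Measurable φ')
    (hlim : ∀ q, Tendsto (fun n => φ n q) atTop (𝓝 (φ' q))) {B : X → ℝ} (hB : MemLp B 2 ν)
    (hbd : ∀ n q, |(φ n q).2| ≤ B q) {T : ℕ → Fin N → Feat p × ℝ} {T' : Fin N → Feat p × ℝ}
    (hT : Tendsto T atTop (𝓝 T')) {b : ℕ → Feat p} {b' : Feat p}
    (hb : Tendsto b atTop (𝓝 b'))
    (hties : ∀ i q, |inner ℝ b' (T' i).1 - inner ℝ b' (φ' q).1| ≠ 1 / 2) :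
    Tendsto (fun n => mse (ν.map (φ n)) boxKernel (1 / 2) (T n) (b n)) atTop
      (𝓝 (mse (ν.map φ') boxKernel (1 / 2) T' b')) := by
  have hm : ∀ (T : Fin N → Feat p × ℝ) (b : Feat p), Measurable fun w : Feat p × ℝ =>
      ENNReal.ofReal ((w.2 - kernelEstimator boxKernel (1 / 2) T b (inner ℝ b w.1)) ^ 2) := by
    intro T b
    have : Measurable fun w : Feat p × ℝ =>
        kernelEstimator boxKernel (1 / 2) T b (inner ℝ b w.1) :=
      measurable_kernelEstimator measurable_boxKernel _ measurable_const measurable_const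
        (by fun_prop)
    fun_prop
  have hY : Tendsto (fun n => ∑ i, |(T n i).2|) atTop (𝓝 (∑ i, |(T' i).2|)) :=
    tendsto_finsetSum _ fun i _ => ((tendsto_pi_nhds.1 hT i).snd_nhds).abs
  obtain ⟨C, hC⟩ := hY.bddAbove_range
  have hC' : ∀ n, ∑ i, |(T n i).2| ≤ C := fun n => hC ⟨n, rfl⟩
  simp only [mse, lintegral_map (hm _ _) (hφ _), lintegral_map (hm _ _) hφ']
  have hBC : MemLp (fun q => B q + C) 2 ν := hB.add (memLp_const C)
  refine tendsto_lintegral_of_dominated_convergence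
    (fun q => ENNReal.ofReal ((B q + C) ^ 2)) (fun n => (hm _ _).comp (hφ n)) ?_ ?_ ?_
  · refine fun n => Eventually.of_forall fun q => ENNReal.ofReal_le_ofReal ?_
    rw [← sq_abs]
    refine pow_le_pow_left₀ (abs_nonneg _) ?_ 2
    refine (abs_sub _ _).trans (add_le_add (hbd n q) ?_)
    exact (abs_kernelEstimator_le boxKernel_nonneg _ _ _ _).trans (hC' n)
  · have := hBC.integrable_sq
    exact (this.lintegral_lt_top).ne
  · refine Eventually.of_forall fun q => ?_
    refine (ENNReal.continuous_ofReal.tendsto _).comp (Tendsto.pow (Tendsto.sub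
      (hlim q).snd_nhds ?_) 2)
    exact tendsto_kernelEstimator hT hb (hb.inner (hlim q).fst_nhds) fun i => hties i q

end Continuity

/-! ### The limiting errors -/

section LimitRisk

variable {p N : ℕ} {u : Feat p}

/-- The normalised training data in the limit. -/
noncomputable def limData (u : Feat p) (k : Fin N → Fin 2) (w : Fin N → Feat p) :
    Fin N → Feat p × ℝ :=
  fun i => limObs u (k i) (w i)

lemma inner_limObs (hu : ‖u‖ = 1) (k : Fin 2) (w : Feat p) :
    inner ℝ u (limObs u k w).1 = lab k := by
  simp only [limObs]
  rw [inner_add_right, inner_direction_stretch hu, real_inner_smul_right,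
    real_inner_self_eq_norm_sq, hu]
  ring

lemma mixed_limData_snd (k : Fin N → Fin 2) (w : Fin N → Feat p) (A : Choices N) (i : Fin N) :
    (mixed (limData u k w) A i).2
      = (A i).2 * lab (k i) + (1 - (A i).2) * lab (k (A i).1) := by
  simp [mixed, limData, limObs]

lemma inner_mixed_limData (hu : ‖u‖ = 1) (k : Fin N → Fin 2) (w : Fin N → Feat p) (A : Choices N)
    (i : Fin N) :
    inner ℝ u (mixed (limData u k w) A i).1 = (mixed (limData u k w) A i).2 := by
  rw [mixed_limData_snd]
  simp [mixed, limData, inner_add_right, real_inner_smul_right, inner_limObs hu]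

/-- A mixing ratio that is neither degenerate nor at the boundary of a kernel window. -/
def GoodRatio (r : ℝ) : Prop := 0 < r ∧ r < 1 ∧ r ≠ 1 / 2

lemma mixed_limData_mem_Icc (k : Fin N → Fin 2) (w : Fin N → Feat p) {A : Choices N} {i : Fin N}
    (hA : GoodRatio (A i).2) : (mixed (limData u k w) A i).2 ∈ Set.Icc (0 : ℝ) 1 := by
  obtain ⟨h0, h1, -⟩ := hA
  rw [mixed_limData_snd]
  rcases lab_eq_zero_or_one (k i) with h | h <;>
    rcases lab_eq_zero_or_one (k (A i).1) with h' | h' <;> rw [h, h'] <;>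
    constructor <;> linarith

lemma mixed_limData_of_eq {k : Fin N → Fin 2} (w : Fin N → Feat p) {A : Choices N} {i : Fin N}
    (h : k (A i).1 = k i) : (mixed (limData u k w) A i).2 = lab (k i) := by
  rw [mixed_limData_snd, h]; ring

lemma mixed_limData_of_ne {k : Fin N → Fin 2} (w : Fin N → Feat p) {A : Choices N} {i : Fin N}
    (hA : GoodRatio (A i).2) (h : k (A i).1 ≠ k i) :
    GoodRatio (mixed (limData u k w) A i).2 := by
  obtain ⟨h0, h1, h2⟩ := hA
  have hne : lab (k (A i).1) ≠ lab (k i) := fun e => h (lab_injective e)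
  rw [mixed_limData_snd]
  rcases lab_eq_zero_or_one (k i) with h | h <;>
    rcases lab_eq_zero_or_one (k (A i).1) with h' | h' <;> rw [h, h'] at hne ⊢
  · exact absurd rfl hne
  · exact ⟨by linarith, by linarith, fun e => h2 (by linarith)⟩
  · exact ⟨by linarith, by linarith, fun e => h2 (by linarith)⟩
  · exact absurd rfl hne

/-- In the limit no augmented observation lies on the boundary of the window of a cluster. -/
lemma mixed_limData_no_ties (hu : ‖u‖ = 1) (k : Fin N → Fin 2) (w : Fin N → Feat p)
    {A : Choices N} (hA : ∀ i, GoodRatio (A i).2) (i : Fin N) (k' : Fin 2) (w' : Feat p) :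
    |inner ℝ u (mixed (limData u k w) A i).1 - inner ℝ u (limObs u k' w').1| ≠ 1 / 2 := by
  rw [inner_mixed_limData hu, inner_limObs hu]
  by_cases h : k (A i).1 = k i
  · rw [mixed_limData_of_eq w h]
    rcases lab_eq_zero_or_one (k i) with h | h <;>
      rcases lab_eq_zero_or_one k' with h' | h' <;> rw [h, h'] <;> norm_num
  · have hg : GoodRatio (mixed (limData u k w) A i).2 := mixed_limData_of_ne w (hA i) h
    obtain ⟨h0, h1, h2⟩ := hg
    rcases lab_eq_zero_or_one k' with h' | h' <;> rw [h']
    · rw [sub_zero, abs_of_pos h0]; exact h2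
    · rw [abs_sub_comm, abs_of_pos (by linarith)]
      intro e; exact h2 (by linarith)

@[fun_prop]
lemma measurable_limObs (u : Feat p) :
    Measurable (fun q : Fin 2 × Latent p => limObs u q.1 q.2.1) := by
  unfold limObs; fun_prop

/-- The error in the limit at the exact fit `u`, in terms of the fresh latent variables. -/
lemma mse_limit_eq (ν : Measure (Fin 2 × Latent p)) (hu : ‖u‖ = 1) (T : Fin N → Feat p × ℝ) :
    mse (ν.map fun q => limObs u q.1 q.2.1) boxKernel (1 / 2) T u
      = ∫⁻ q, ENNReal.ofReal
        ((lab q.1 - kernelEstimator boxKernel (1 / 2) T u (lab q.1)) ^ 2) ∂ν := by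
  have hm : Measurable fun w : Feat p × ℝ =>
      kernelEstimator boxKernel (1 / 2) T u (inner ℝ u w.1) :=
    measurable_kernelEstimator measurable_boxKernel _ measurable_const measurable_const
      (by fun_prop)
  rw [mse, lintegral_map (by fun_prop) (by fun_prop)]
  simp only [inner_limObs hu]
  rfl

/-- Mixing within clusters leaves no error in the limit. -/
lemma mse_limit_eq_zero (ν : Measure (Fin 2 × Latent p)) (hu : ‖u‖ = 1) {k : Fin N → Fin 2}
    (w : Fin N → Feat p) {A : Choices N} (hk : ∀ c, ∃ i, k i = c)
    (hA : ∀ i, k (A i).1 = k i) :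
    mse (ν.map fun q => limObs u q.1 q.2.1) boxKernel (1 / 2) (mixed (limData u k w) A) u
      = 0 := by
  rw [mse_limit_eq ν hu]
  have key : ∀ c, kernelEstimator boxKernel (1 / 2) (mixed (limData u k w) A) u (lab c)
      = lab c := by
    intro c
    simp only [kernelEstimator, inner_mixed_limData hu, mixed_limData_of_eq w (hA _)]
    have e : ∀ i, boxKernel ((lab (k i) - lab c) / (1 / 2))
        = if k i = c then 1 / 2 else 0 := fun i => by
      by_cases h : k i = c
      · simp [h, boxKernel]
      · have : lab (k i) ≠ lab c := fun h' => h (lab_injective h')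
        simp only [h, if_false]
        rcases lab_eq_zero_or_one (k i) with h1 | h1 <;>
          rcases lab_eq_zero_or_one c with h2 | h2 <;> rw [h1, h2] at this ⊢ <;>
          first | exact absurd rfl this | norm_num [boxKernel]
    have e2 : ∀ i, boxKernel ((lab (k i) - lab c) / (1 / 2)) * lab (k i)
        = boxKernel ((lab (k i) - lab c) / (1 / 2)) * lab c := fun i => by
      rw [e]; split_ifs with h <;> simp [h]
    rw [Finset.sum_congr rfl fun i _ => e2 i, ← Finset.sum_mul, mul_div_assoc, mul_comm,
      div_mul_cancel₀]
    obtain ⟨i, hi⟩ := hk c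
    refine (Finset.sum_pos' (fun i _ => boxKernel_nonneg _) ⟨i, Finset.mem_univ i, ?_⟩).ne'
    rw [e, if_pos hi]; norm_num
  simp only [key]
  simp

/-- Mixing between clusters leaves an error in the limit. -/
lemma mse_limit_pos (ρ : Measure (Latent p)) [IsProbabilityMeasure ρ] (hu : ‖u‖ = 1)
    {k : Fin N → Fin 2} (w : Fin N → Feat p) {A : Choices N} (hA : ∀ i, GoodRatio (A i).2)
    {i : Fin N} (hi : k (A i).1 ≠ k i) :
    0 < mse ((clusterLaw.prod ρ).map fun q => limObs u q.1 q.2.1) boxKernel (1 / 2)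
      (mixed (limData u k w) A) u := by
  rw [mse_limit_eq _ hu]
  set T := mixed (limData u k w) A
  suffices h : ∃ c, kernelEstimator boxKernel (1 / 2) T u (lab c) ≠ lab c by
    obtain ⟨c, hc⟩ := h
    have hpos : 0 < ENNReal.ofReal ((lab c - kernelEstimator boxKernel (1 / 2) T u (lab c)) ^ 2) :=
      ENNReal.ofReal_pos.2 (sq_pos_of_ne_zero (sub_ne_zero.2 hc.symm))
    have hm : MeasurableSet {q : Fin 2 × Latent p | q.1 = c} :=
      measurableSet_eq_fun (by fun_prop) (by fun_prop)
    refine lt_of_lt_of_le ?_ (setLIntegral_le_lintegral {q : Fin 2 × Latent p | q.1 = c} _)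
    rw [setLIntegral_congr_fun hm (g := fun _ => ENNReal.ofReal
      ((lab c - kernelEstimator boxKernel (1 / 2) T u (lab c)) ^ 2))
      (fun q hq => by simp only [show q.1 = c from hq]), setLIntegral_const]
    refine ENNReal.mul_pos hpos.ne' ?_
    have : {q : Fin 2 × Latent p | q.1 = c} = {c} ×ˢ Set.univ := by ext; simp
    rw [this, Measure.prod_prod, clusterLaw]
    simp
  have hv : GoodRatio (T i).2 := mixed_limData_of_ne w (hA i) hi
  have hmem : ∀ j, (T j).2 ∈ Set.Icc (0 : ℝ) 1 := fun j => mixed_limData_mem_Icc k w (hA j)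
  have hin : ∀ j, inner ℝ u (T j).1 = (T j).2 := inner_mixed_limData hu k w A
  obtain ⟨h0, h1, h2⟩ := hv
  rcases lt_or_gt_of_ne h2 with h | h
  · -- the observation is a positive term in the window of the cluster at `0`
    refine ⟨0, ?_⟩
    have hl : lab 0 = 0 := by simp [lab]
    simp only [kernelEstimator, hin, hl, sub_zero]
    have hw : 0 < boxKernel ((T i).2 / (1 / 2)) := by
      rw [boxKernel, if_pos]; · norm_num
      rw [abs_of_pos (by positivity), div_le_one (by norm_num)]; exact h.le
    refine (div_pos ?_ ?_).ne'
    · exact Finset.sum_pos' (fun j _ => mul_nonneg (boxKernel_nonneg _) (hmem j).1)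
        ⟨i, Finset.mem_univ i, mul_pos hw h0⟩
    · exact Finset.sum_pos' (fun j _ => boxKernel_nonneg _) ⟨i, Finset.mem_univ i, hw⟩
  · -- the observation is a term below `1` in the window of the cluster at `1`
    refine ⟨1, ?_⟩
    have hl : lab 1 = 1 := by simp [lab]
    simp only [kernelEstimator, hin, hl]
    have hw : 0 < boxKernel (((T i).2 - 1) / (1 / 2)) := by
      rw [boxKernel, if_pos]; · norm_num
      rw [abs_le]
      constructor
      · rw [le_div_iff₀ (by norm_num)]; linarith
      · rw [div_le_iff₀ (by norm_num)]; linarith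
    have hs : 0 < ∑ j, boxKernel (((T j).2 - 1) / (1 / 2)) :=
      Finset.sum_pos' (fun j _ => boxKernel_nonneg _) ⟨i, Finset.mem_univ i, hw⟩
    refine ((div_lt_one hs).2 ?_).ne
    refine Finset.sum_lt_sum (fun j _ => mul_le_of_le_one_right (boxKernel_nonneg _) (hmem j).2)
      ⟨i, Finset.mem_univ i, mul_lt_of_lt_one_right hw h1⟩

end LimitRisk

/-! ### The least squares solution as a measurable function of the data -/

section Gram

variable {p N : ℕ}

/-- The Gram matrix `∑ i, x̃ᵢ x̃ᵢᵀ` of the features. -/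
noncomputable def gram (T : Fin N → Feat p × ℝ) : Matrix (Fin p) (Fin p) ℝ :=
  Matrix.of fun a b => ∑ i, (T i).1 a * (T i).1 b

lemma gram_mulVec (T : Fin N → Feat p × ℝ) (c : Feat p) (a : Fin p) :
    (gram T).mulVec (WithLp.ofLp c) a = ∑ i, (T i).1 a * inner ℝ c (T i).1 := by
  simp only [gram, Matrix.mulVec, dotProduct, Matrix.of_apply, PiLp.inner_apply, Finset.mul_sum,
    Finset.sum_mul]
  rw [Finset.sum_comm]
  refine Finset.sum_congr rfl fun i _ => Finset.sum_congr rfl fun b _ => ?_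
  simp; ring

lemma fullRank_iff_det_gram {T : Fin N → Feat p × ℝ} : FullRank T ↔ (gram T).det ≠ 0 := by
  rw [← not_iff_not, not_not, ← Matrix.exists_mulVec_eq_zero_iff]
  constructor
  · intro h
    simp only [FullRank, not_forall] at h
    obtain ⟨c, hc, hne⟩ := h
    refine ⟨WithLp.ofLp c, by simpa using hne, ?_⟩
    ext a
    rw [gram_mulVec]
    simp [hc]
  · rintro ⟨v, hv, h0⟩ hfull
    refine hv ?_
    have : (WithLp.toLp 2 v : Feat p) = 0 := by
      refine hfull _ fun i => ?_
      have hs : ∑ i, inner ℝ (WithLp.toLp 2 v : Feat p) (T i).1 ^ 2 = 0 := by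
        have e : ∑ a, v a * (gram T).mulVec v a = 0 := by simp [h0]
        rw [← e]
        have : ∀ a, (gram T).mulVec v a
            = ∑ i, (T i).1 a * inner ℝ (WithLp.toLp 2 v : Feat p) (T i).1 :=
          fun a => gram_mulVec T (WithLp.toLp 2 v) a
        simp only [this, Finset.mul_sum]
        rw [Finset.sum_comm]
        refine Finset.sum_congr rfl fun i _ => ?_
        rw [pow_two]
        nth_rw 1 [PiLp.inner_apply]
        rw [Finset.sum_mul]
        refine Finset.sum_congr rfl fun a _ => ?_
        simp; ring
      have := (Finset.sum_eq_zero_iff_of_nonneg fun i _ => sq_nonneg _).1 hs i (Finset.mem_univ i)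
      simpa using this
    simpa using this

/-- The solution `(∑ i, x̃ᵢ x̃ᵢᵀ)⁻¹ ∑ i, ỹᵢ x̃ᵢ` of the normal equations. -/
noncomputable def lsSol (T : Fin N → Feat p × ℝ) : Feat p :=
  WithLp.toLp 2 ((gram T)⁻¹.mulVec fun a => ∑ i, (T i).1 a * (T i).2)

lemma normal_equations {T : Fin N → Feat p × ℝ} (h : FullRank T) (c : Feat p) :
    ∑ i, ((T i).2 - inner ℝ (lsSol T) (T i).1) * inner ℝ c (T i).1 = 0 := by
  have hdet : IsUnit (gram T).det := (fullRank_iff_det_gram.1 h).isUnit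
  have h1 : ∀ a, ∑ i, (T i).1 a * inner ℝ (lsSol T) (T i).1 = ∑ i, (T i).1 a * (T i).2 := by
    intro a
    rw [← gram_mulVec]
    have : (gram T).mulVec (WithLp.ofLp (lsSol T)) = fun a => ∑ i, (T i).1 a * (T i).2 := by
      simp [lsSol, Matrix.mulVec_mulVec, Matrix.mul_nonsing_inv _ hdet]
    exact congrFun this a
  have h2 : ∀ i, inner ℝ c (T i).1 = ∑ a, c a * (T i).1 a := fun i => by
    simp [PiLp.inner_apply, mul_comm]
  simp only [h2, Finset.mul_sum]
  rw [Finset.sum_comm]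
  refine Finset.sum_eq_zero fun a _ => ?_
  have e : ∀ i, ((T i).2 - inner ℝ (lsSol T) (T i).1) * (c a * (T i).1 a)
      = c a * ((T i).1 a * (T i).2 - (T i).1 a * inner ℝ (lsSol T) (T i).1) := fun i => by ring
  simp only [e]
  rw [← Finset.mul_sum, Finset.sum_sub_distrib, h1, sub_self, mul_zero]

lemma sum_sq_residual {T : Fin N → Feat p × ℝ} (h : FullRank T) (b : Feat p) :
    ∑ i, ((T i).2 - inner ℝ b (T i).1) ^ 2
      = ∑ i, ((T i).2 - inner ℝ (lsSol T) (T i).1) ^ 2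
        + ∑ i, inner ℝ (b - lsSol T) (T i).1 ^ 2 := by
  have hn := normal_equations h (b - lsSol T)
  have e : ∀ i, ((T i).2 - inner ℝ b (T i).1) ^ 2
      = ((T i).2 - inner ℝ (lsSol T) (T i).1) ^ 2 + inner ℝ (b - lsSol T) (T i).1 ^ 2
        - 2 * (((T i).2 - inner ℝ (lsSol T) (T i).1) * inner ℝ (b - lsSol T) (T i).1) :=
    fun i => by rw [inner_sub_left]; ring
  simp only [e]
  rw [Finset.sum_sub_distrib, Finset.sum_add_distrib, ← Finset.mul_sum, hn]
  ring

lemma isLeastSquares_lsSol {T : Fin N → Feat p × ℝ} (h : FullRank T) :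
    IsLeastSquares T (lsSol T) := by
  intro b
  rw [sum_sq_residual h b]
  exact le_add_of_nonneg_right (Finset.sum_nonneg fun i _ => sq_nonneg _)

lemma IsLeastSquares.eq_lsSol {T : Fin N → Feat p × ℝ} (h : FullRank T) {b : Feat p}
    (hb : IsLeastSquares T b) : b = lsSol T := by
  have h1 := hb (lsSol T)
  rw [sum_sq_residual h b] at h1
  have h2 : ∑ i, inner ℝ (b - lsSol T) (T i).1 ^ 2 = 0 :=
    le_antisymm (by linarith) (Finset.sum_nonneg fun i _ => sq_nonneg _)
  refine sub_eq_zero.1 (h _ fun i => ?_)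
  have := (Finset.sum_eq_zero_iff_of_nonneg fun i _ => sq_nonneg _).1 h2 i (Finset.mem_univ i)
  simpa using this

lemma continuous_gram : Continuous (gram : (Fin N → Feat p × ℝ) → Matrix (Fin p) (Fin p) ℝ) := by
  refine continuous_matrix fun a b => ?_
  simp only [gram, Matrix.of_apply]
  fun_prop

@[fun_prop]
lemma measurable_lsSol : Measurable (lsSol : (Fin N → Feat p × ℝ) → Feat p) := by
  have h1 : ∀ a b, Measurable fun T : Fin N → Feat p × ℝ => (gram T)⁻¹ a b := fun a b => by
    have hd : Measurable fun T : Fin N → Feat p × ℝ => (gram T).det :=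
      continuous_gram.matrix_det.measurable
    have ha : Measurable fun T : Fin N → Feat p × ℝ => (gram T).adjugate a b :=
      (continuous_gram.matrix_adjugate.matrix_elem a b).measurable
    simp only [Matrix.inv_def, Ring.inverse_eq_inv', Matrix.smul_apply, smul_eq_mul]
    exact hd.inv.mul ha
  unfold lsSol
  refine (WithLp.measurable_toLp 2 _).comp (measurable_pi_lambda _ fun a => ?_)
  simp only [Matrix.mulVec, dotProduct]
  refine Finset.measurable_sum _ fun b _ => (h1 a b).mul ?_
  fun_prop

lemma measurableSet_fullRank : MeasurableSet {T : Fin N → Feat p × ℝ | FullRank T} := by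
  simp only [fullRank_iff_det_gram]
  exact (measurableSet_singleton (0 : ℝ)).compl.preimage continuous_gram.matrix_det.measurable

end Gram

/-! ### The law of the partners -/

section Partners

variable {p N : ℕ} (d : Feat p × ℝ → Feat p × ℝ → ℝ) (σ : ℝ)

lemma pairWeight_nonneg (D : Fin N → Feat p × ℝ) (i j : Fin N) : 0 ≤ pairWeight d σ D i j := by
  unfold pairWeight; split_ifs <;> positivity

lemma pairProb_nonneg (D : Fin N → Feat p × ℝ) (i j : Fin N) : 0 ≤ pairProb d σ D i j :=
  div_nonneg (pairWeight_nonneg d σ D i j)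
    (Finset.sum_nonneg fun l _ => pairWeight_nonneg d σ D i l)

lemma sum_pairProb_le_one (D : Fin N → Feat p × ℝ) (i : Fin N) :
    ∑ j, pairProb d σ D i j ≤ 1 := by
  simp only [pairProb]
  rw [← Finset.sum_div]
  exact div_self_le_one _

lemma pairProb_le_one (D : Fin N → Feat p × ℝ) (i j : Fin N) : pairProb d σ D i j ≤ 1 :=
  (Finset.single_le_sum (fun l _ => pairProb_nonneg d σ D i l) (Finset.mem_univ j)).trans
    (sum_pairProb_le_one d σ D i)

lemma pairProb_self (D : Fin N → Feat p × ℝ) (i : Fin N) : pairProb d σ D i i = 0 := by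
  simp [pairProb, pairWeight]

/-- The probability of a partner is small if another candidate is much closer. -/
lemma pairProb_le_exp (D : Fin N → Feat p × ℝ) {i l : Fin N} (hl : l ≠ i) (j : Fin N) :
    pairProb d σ D i j ≤ Real.exp (-(d (D i) (D j) - d (D i) (D l)) / (2 * σ ^ 2)) := by
  by_cases hj : j = i
  · rw [hj, pairProb_self]; exact (Real.exp_pos _).le
  have h1 : pairWeight d σ D i l ≤ ∑ l, pairWeight d σ D i l :=
    Finset.single_le_sum (fun l _ => pairWeight_nonneg d σ D i l) (Finset.mem_univ l)
  rw [pairWeight, if_neg hl] at h1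
  rw [pairProb, pairWeight, if_neg hj, neg_sub, sub_div, sub_eq_neg_add, Real.exp_add,
    div_le_iff₀ ((Real.exp_pos _).trans_le h1), ← neg_div, mul_assoc]
  refine le_mul_of_one_le_right (Real.exp_pos _).le ?_
  refine le_trans ?_ (mul_le_mul_of_nonneg_left h1 (Real.exp_pos _).le)
  rw [← Real.exp_add, ← add_div, add_neg_cancel, zero_div, Real.exp_zero]

lemma choicesDensity_le (D : Fin N → Feat p × ℝ) (A : Choices N) (i : Fin N) :
    choicesDensity d σ D A ≤ ENNReal.ofReal (pairProb d σ D i (A i).1) := by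
  rw [choicesDensity, ← Finset.mul_prod_erase _ _ (Finset.mem_univ i)]
  refine mul_le_of_le_one_right' (Finset.prod_le_one' fun j _ => ?_)
  exact ENNReal.ofReal_le_one.2 (pairProb_le_one d σ D j _)

lemma choicesDensity_le_one (D : Fin N → Feat p × ℝ) (A : Choices N) :
    choicesDensity d σ D A ≤ 1 :=
  Finset.prod_le_one' fun j _ => ENNReal.ofReal_le_one.2 (pairProb_le_one d σ D j _)

lemma choicesDensity_eq_zero (D : Fin N → Feat p × ℝ) {A : Choices N} {i : Fin N}
    (h : (A i).1 = i) : choicesDensity d σ D A = 0 := by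
  have := choicesDensity_le d σ D A i
  rw [h, pairProb_self] at this
  simpa using this

/-- The density of a choice of partners vanishes in the limit if one of the partners is much
farther away than another candidate. -/
lemma tendsto_choicesDensity {σ : ℝ} (hσ : 0 < σ) {D : ℕ → Fin N → Feat p × ℝ} {A : Choices N}
    {i l : Fin N} (hl : l ≠ i)
    (h : Tendsto (fun n => d (D n i) (D n (A i).1) - d (D n i) (D n l)) atTop atTop) :
    Tendsto (fun n => choicesDensity d σ (D n) A) atTop (𝓝 0) := by
  have h1 : Tendsto (fun n => ENNReal.ofReal (Real.exp
      (-(d (D n i) (D n (A i).1) - d (D n i) (D n l)) / (2 * σ ^ 2)))) atTop (𝓝 0) := by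
    rw [← ENNReal.ofReal_zero]
    refine (ENNReal.continuous_ofReal.tendsto _).comp (Real.tendsto_exp_atBot.comp ?_)
    exact (tendsto_neg_atTop_atBot.comp h).atBot_div_const (by positivity)
  refine tendsto_of_tendsto_of_tendsto_of_le_of_le tendsto_const_nhds h1 (fun _ => zero_le)
    fun n => ?_
  exact (choicesDensity_le d σ (D n) A i).trans
    (ENNReal.ofReal_le_ofReal (pairProb_le_exp d σ (D n) hl _))

lemma lintegral_choicesDensity_le_one {α : ℝ} (hα : 0 < α) (D : Fin N → Feat p × ℝ) :
    ∫⁻ A, choicesDensity d σ D A ∂choicesRef α N ≤ 1 := by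
  have := isProbabilityMeasureBeta hα hα
  have hint : ∀ i, Integrable (fun a : Fin N × ℝ => pairProb d σ D i a.1)
      ((Measure.count : Measure (Fin N)).prod (betaMeasure α α)) := fun i => by
    refine Integrable.of_bound (C := 1) ?_ (Eventually.of_forall fun a => ?_)
    · have : Measurable (pairProb d σ D i) := measurable_of_finite _
      exact (this.comp measurable_fst).aestronglyMeasurable
    · rw [Real.norm_eq_abs, abs_of_nonneg (pairProb_nonneg d σ D i a.1)]
      exact pairProb_le_one d σ D i a.1
  have hle : ∀ i, ∫ a, pairProb d σ D i a.1
      ∂((Measure.count : Measure (Fin N)).prod (betaMeasure α α)) ≤ 1 := fun i => by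
    rw [integral_fun_fst, integral_count]
    simpa using sum_pairProb_le_one d σ D i
  have e : ∀ A : Choices N, choicesDensity d σ D A
      = ENNReal.ofReal (∏ i, pairProb d σ D i (A i).1) := fun A => by
    rw [choicesDensity, ENNReal.ofReal_prod_of_nonneg fun i _ => pairProb_nonneg d σ D i _]
  simp only [e]
  rw [choicesRef, ← ofReal_integral_eq_lintegral_ofReal (Integrable.fintype_prod_dep hint)
    (Eventually.of_forall fun A => Finset.prod_nonneg fun i _ => pairProb_nonneg d σ D i _),
    integral_fintype_prod_eq_prod (f := fun i (a : Fin N × ℝ) => pairProb d σ D i a.1)]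
  refine ENNReal.ofReal_le_one.2 (Finset.prod_le_one (fun i _ => ?_) fun i _ => hle i)
  exact integral_nonneg fun a => pairProb_nonneg d σ D i _

lemma choicesDensity_distVanilla (D D' : Fin N → Feat p × ℝ) (A : Choices N) :
    choicesDensity distVanilla σ D A = choicesDensity distVanilla σ D' A := by
  simp [choicesDensity, pairProb, pairWeight, distVanilla]

lemma measurable_eval_index {X E : Type*} [MeasurableSpace X] [MeasurableSpace E]
    {f : X → Fin N → E} {j : X → Fin N} (hf : Measurable f) (hj : Measurable j) :
    Measurable fun x => f x (j x) := by
  have : Measurable fun q : (Fin N → E) × Fin N => q.1 q.2 :=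
    measurable_from_prod_countable_left fun j => measurable_pi_apply j
  exact this.comp (hf.prodMk hj)

@[fun_prop]
lemma measurable_mixed {X : Type*} [MeasurableSpace X] {D : X → Fin N → Feat p × ℝ}
    {A : X → Choices N} (hD : Measurable D) (hA : Measurable A) :
    Measurable fun x => mixed (D x) (A x) := by
  unfold mixed
  refine measurable_pi_lambda _ fun i => ?_
  have h1 : Measurable fun x => D x (A x i).1 := measurable_eval_index hD (by fun_prop)
  have h2 : Measurable fun x => D x i := by fun_prop
  have h3 : Measurable fun x => (A x i).2 := by fun_prop
  exact (h3.smul h2).add ((measurable_const.sub h3).smul h1)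

lemma measurable_choicesDensity {X : Type*} [MeasurableSpace X]
    (hd : Measurable fun q : (Feat p × ℝ) × (Feat p × ℝ) => d q.1 q.2)
    {D : X → Fin N → Feat p × ℝ} {A : X → Choices N} (hD : Measurable D) (hA : Measurable A) :
    Measurable fun x => choicesDensity d σ (D x) (A x) := by
  have hw : ∀ i j, Measurable fun x => pairWeight d σ (D x) i j := fun i j => by
    unfold pairWeight
    split_ifs
    · fun_prop
    · have : Measurable fun x => d (D x i) (D x j) :=
        hd.comp (((measurable_pi_apply i).comp hD).prodMk ((measurable_pi_apply j).comp hD))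
      fun_prop
  have hp : ∀ i, Measurable fun x j => pairProb d σ (D x) i j := fun i => by
    unfold pairProb
    fun_prop
  unfold choicesDensity
  refine Finset.measurable_prod _ fun i _ => ENNReal.measurable_ofReal.comp ?_
  exact measurable_eval_index (hp i) (by fun_prop)

end Partners

/-! ### Random labellings of the clusters -/

section Labels

variable {N : ℕ}

lemma clusterLaw_singleton (c : Fin 2) : clusterLaw {c} = (2 : ℝ≥0∞)⁻¹ := by
  simp [clusterLaw]

lemma pi_clusterLaw_apply (s : Finset (Fin N → Fin 2)) :
    Measure.pi (fun _ : Fin N => clusterLaw) (s : Set (Fin N → Fin 2))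
      = s.card * (2 ^ N : ℝ≥0∞)⁻¹ := by
  rw [← sum_measure_singleton]
  simp [Measure.pi_singleton, clusterLaw_singleton, ENNReal.inv_pow]

/-- For a map `π` without fixed points, at most a fraction `2 / N` of the labellings with two labels
is invariant under `π`: flipping the label at `i` in an invariant labelling makes `i` and `π i`
disagree, so if a given labelling arises in this way, at most two indices can have been flipped. -/
lemma card_invariant_le (π : Fin N → Fin N) (hπ : ∀ i, π i ≠ i) :
    N * (Finset.univ.filter fun k : Fin N → Fin 2 => ∀ i, k (π i) = k i).card ≤ 2 * 2 ^ N := by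
  classical
  set I := Finset.univ.filter fun k : Fin N → Fin 2 => ∀ i, k (π i) = k i
  let F : (Fin N → Fin 2) × Fin N → (Fin N → Fin 2) := fun q => Function.update q.1 q.2 (q.1 q.2 + 1)
  have hadd : ∀ a : Fin 2, a + 1 ≠ a := by decide
  have hcard : (I ×ˢ (Finset.univ : Finset (Fin N))).card
      ≤ 2 * (Finset.univ : Finset (Fin N → Fin 2)).card := by
    refine Finset.card_le_mul_card_image_of_maps_to (f := F) (fun _ _ => Finset.mem_univ _) 2
      fun k' _ => ?_
    set S := (I ×ˢ (Finset.univ : Finset (Fin N))).filter fun q => F q = k'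
    rcases S.eq_empty_or_nonempty with h0 | ⟨⟨k, i⟩, hki⟩
    · rw [h0]; simp
    have hinv : ∀ q ∈ S, (∀ j, q.1 (π j) = q.1 j) ∧ F q = k' := fun q hq => by
      simpa [S, I] using hq
    have hinj : Set.InjOn Prod.snd (S : Set ((Fin N → Fin 2) × Fin N)) := by
      rintro ⟨a, j⟩ ha ⟨b, j'⟩ hb hjj
      obtain rfl : j = j' := hjj
      have hab := ((hinv _ ha).2.trans (hinv _ hb).2.symm)
      refine Prod.ext (funext fun l => ?_) rfl
      have := congrFun hab l
      by_cases hl : l = j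
      · subst hl
        simpa [F] using this
      · simpa [F, hl] using this
    rw [← Finset.card_image_of_injOn hinj]
    refine (Finset.card_le_card (t := {i, π i}) ?_).trans Finset.card_le_two
    intro j hj
    obtain ⟨⟨b, j'⟩, hb, rfl⟩ := Finset.mem_image.1 hj
    by_contra hne
    simp only [Finset.mem_insert, Finset.mem_singleton, not_or] at hne
    obtain ⟨hji, hjπ⟩ := hne
    have hab := ((hinv _ hki).2.trans (hinv _ hb).2.symm)
    have h1 := congrFun hab i
    have h2 := congrFun hab (π i)
    simp only [F, Function.update_self, Function.update_of_ne (Ne.symm hji),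
      Function.update_of_ne (Ne.symm hjπ), Function.update_of_ne (hπ i)] at h1 h2
    have hk1 : k (π i) = k i := (hinv _ hki).1 i
    have hb1 : b (π i) = b i := (hinv _ hb).1 i
    rw [hk1, hb1, ← h1] at h2
    exact hadd _ h2.symm
  simpa [Finset.card_product, mul_comm] using hcard

lemma measure_invariant_le (π : Fin N → Fin N) (hπ : ∀ i, π i ≠ i) :
    Measure.pi (fun _ : Fin N => clusterLaw) {k | ∀ i, k (π i) = k i} ≤ 2 / (N : ℝ≥0∞) := by
  classical
  have h := card_invariant_le π hπ
  have e : {k : Fin N → Fin 2 | ∀ i, k (π i) = k i}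
      = ((Finset.univ.filter fun k : Fin N → Fin 2 => ∀ i, k (π i) = k i : Finset _) : Set _) := by
    ext; simp
  rw [e, pi_clusterLaw_apply, ENNReal.le_div_iff_mul_le (Or.inr (by simp)) (Or.inl (by simp)),
    mul_right_comm, ← div_eq_mul_inv,
    ENNReal.div_le_iff_le_mul (Or.inl (by simp)) (Or.inl (by simp)), mul_comm (Finset.card _ : ℝ≥0∞)]
  exact_mod_cast h

/-- The probability that some cluster has exactly one member. -/
lemma measure_singleton_cluster_le :
    Measure.pi (fun _ : Fin N => clusterLaw) {k | ∃ i, ∀ j, j ≠ i → k j ≠ k i}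
      ≤ (N * 2 : ℕ) * (2 ^ N : ℝ≥0∞)⁻¹ := by
  classical
  have e : {k : Fin N → Fin 2 | ∃ i, ∀ j, j ≠ i → k j ≠ k i}
      ⊆ ((Finset.univ.image fun q : Fin N × Fin 2 =>
        Function.update (fun _ => q.2 + 1) q.1 q.2 : Finset (Fin N → Fin 2)) : Set _) := by
    rintro k ⟨i, hi⟩
    simp only [Finset.coe_image, Finset.coe_univ, Set.image_univ, Set.mem_range, Prod.exists]
    refine ⟨i, k i, funext fun j => ?_⟩
    by_cases hj : j = i
    · subst hj; simp
    · have h2 : ∀ a b : Fin 2, b ≠ a → a + 1 = b := by decide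
      simpa [hj] using h2 _ _ (hi j hj)
  refine (measure_mono e).trans ?_
  rw [pi_clusterLaw_apply]
  gcongr
  exact_mod_cast Finset.card_image_le.trans_eq (by simp)

end Labels

/-! ### Null sets of analytic functions -/

/-- The zero set of a function that is analytic along the lines through a point where it does not
vanish is a null set: almost every dilation of it about this point is, by Fubini's theorem. -/
lemma ae_ne_zero_of_analytic_lines {E : Type*} [NormedAddCommGroup E] [NormedSpace ℝ E]
    [FiniteDimensional ℝ E] [MeasurableSpace E] [BorelSpace E] (μ : Measure E)
    [μ.IsAddHaarMeasure] {f : E → ℝ} (hf : Measurable f) {a : E} (ha : f a ≠ 0)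
    (han : ∀ v, AnalyticOnNhd ℝ (fun t : ℝ => f (a + t • v)) Set.univ) :
    ∀ᵐ x ∂μ, f x ≠ 0 := by
  have h1 : ∀ v, ∀ᵐ t : ℝ, f (a + t • v) ≠ 0 := fun v => by
    have h := (han v).preimage_zero_mem_codiscrete (x := 0) (by simpa using ha)
    have h' := ae_restrict_le_codiscreteWithin (μ := (volume : Measure ℝ)) (U := Set.univ)
      MeasurableSet.univ h
    rw [Measure.restrict_univ] at h'
    exact h'
  have hm : MeasurableSet {q : E × ℝ | f (a + q.2 • q.1) ≠ 0} :=
    (measurableSet_singleton (0 : ℝ)).compl.preimage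
      (hf.comp (measurable_const.add (measurable_snd.smul measurable_fst)))
  have h2 : ∀ᵐ t : ℝ, ∀ᵐ v ∂μ, f (a + t • v) ≠ 0 := Measure.ae_ae_comm hm |>.1
    (Eventually.of_forall h1)
  have h3 : ∀ᵐ t : ℝ, t ≠ 0 := by simp [ae_iff]
  obtain ⟨t, ht, ht0⟩ := (h2.and h3).exists
  have hq : Measure.QuasiMeasurePreserving (fun x => t⁻¹ • (x - a)) μ μ :=
    (Measure.quasiMeasurePreserving_smul μ (inv_ne_zero ht0)).comp
      (measurePreserving_sub_right μ a).quasiMeasurePreserving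
  filter_upwards [hq.ae ht] with x hx
  simpa [smul_smul, mul_inv_cancel₀ ht0] using hx

lemma analyticAt_det {m : ℕ} {M : ℝ → Matrix (Fin m) (Fin m) ℝ} {t : ℝ}
    (h : ∀ a b, AnalyticAt ℝ (fun t => M t a b) t) : AnalyticAt ℝ (fun t => (M t).det) t := by
  simp only [Matrix.det_apply']
  exact Finset.analyticAt_fun_sum _ fun σ _ =>
    analyticAt_const.mul (Finset.analyticAt_fun_prod _ fun i _ => h _ _)

section Generic

variable {p N : ℕ} {u : Feat p}

/-- The noise vectors can be such that the limiting design has full rank before mixing: the example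
`i₀` of the far cluster supplies the direction `u`, and `p` others the coordinate vectors. -/
lemma exists_fullRank_limData (hN : p + 1 ≤ N) {k : Fin N → Fin 2} {i₀ : Fin N}
    (hk : k i₀ = 1) : ∃ w, FullRank (limData u k w) := by
  classical
  obtain ⟨e⟩ : Nonempty (Fin p ↪ {i : Fin N // i ≠ i₀}) := by
    refine Function.Embedding.nonempty_of_card_le ?_
    simp only [Fintype.card_fin, ne_eq, Fintype.card_subtype_compl, Fintype.card_unique]
    omega
  have he : Function.Injective (fun a => (e a : Fin N)) :=
    Subtype.val_injective.comp e.injective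
  refine ⟨Function.extend (fun a => (e a : Fin N)) (fun a => EuclideanSpace.single a 1) 0,
    fun c hc => ?_⟩
  have h0 : inner ℝ c u = 0 := by
    have := hc i₀
    rw [limData, limObs, Function.extend_apply' _ _ _ (by rintro ⟨a, ha⟩; exact (e a).2 ha), hk]
      at this
    simpa [lab] using this
  ext a
  have := hc (e a)
  rw [limData, limObs, he.extend_apply] at this
  simpa [stretch_apply, inner_add_right, real_inner_smul_right, h0, EuclideanSpace.inner_single_right]
    using this

/-- For fixed clusters and partners, almost all noise vectors and ratios yield an augmented design of
full rank in the limit. -/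
lemma ae_fullRank_limData (hN : p + 1 ≤ N) {k : Fin N → Fin 2} {i₀ : Fin N}
    (hk : k i₀ = 1) (π : Fin N → Fin N) :
    ∀ᵐ q : (Fin N → Feat p) × (Fin N → ℝ),
      FullRank (mixed (limData u k q.1) fun i => (π i, q.2 i)) := by
  obtain ⟨w₀, hw₀⟩ := exists_fullRank_limData (u := u) hN hk
  let f : (Fin N → Feat p) × (Fin N → ℝ) → ℝ := fun q =>
    (gram (mixed (limData u k q.1) fun i => (π i, q.2 i))).det
  have hf : Measurable f := by
    refine continuous_gram.matrix_det.measurable.comp ?_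
    refine measurable_mixed ?_ ?_
    · unfold limData limObs; fun_prop
    · fun_prop
  -- with all ratios equal to `1` the augmented data are the original ones
  have ha : f (w₀, fun _ => 1) ≠ 0 := by
    have e : (mixed (limData u k w₀) fun i => (π i, 1)) = limData u k w₀ := by
      funext i; simp [mixed]
    simp only [f, e]
    exact fullRank_iff_det_gram.1 hw₀
  have : ((volume : Measure (Fin N → Feat p)).prod
      (volume : Measure (Fin N → ℝ))).IsAddHaarMeasure :=
    Measure.prod.instIsAddHaarMeasure _ _
  have key := ae_ne_zero_of_analytic_lines
    ((volume : Measure (Fin N → Feat p)).prod (volume : Measure (Fin N → ℝ)))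
    hf ha ?_
  · filter_upwards [key] with q hq
    exact fullRank_iff_det_gram.2 hq
  rintro ⟨v, r⟩ t -
  refine analyticAt_det fun a b => ?_
  have hc : ∀ i a, AnalyticAt ℝ (fun t : ℝ =>
      (mixed (limData u k (w₀ + t • v)) fun i => (π i, (1 : ℝ) + t * r i)) i |>.1 a) t := by
    intro i a
    simp only [mixed, limData, limObs, stretch_apply, Pi.add_apply, Pi.smul_apply, inner_add_right,
      real_inner_smul_right, Prod.fst_add, Prod.smul_fst, PiLp.add_apply, PiLp.smul_apply,
      smul_eq_mul]
    fun_prop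
  simp only [gram, Matrix.of_apply]
  exact Finset.analyticAt_fun_sum _ fun i _ => (hc i a).mul (hc i b)

lemma exists_inner_eq_zero (hp : 2 ≤ p) (hu : ‖u‖ = 1) : ∃ v : Feat p, v ≠ 0 ∧ inner ℝ u v = 0 := by
  have h := Submodule.finrank_add_finrank_orthogonal (ℝ ∙ u)
  have h1 := finrank_span_singleton (K := ℝ) (v := u) (norm_ne_zero_iff.1 (by simp [hu]))
  rw [finrank_euclideanSpace_fin] at h
  have h2 : 0 < Module.finrank ℝ ((ℝ ∙ u)ᗮ : Submodule ℝ (Feat p)) := by omega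
  obtain ⟨v, hv⟩ := Module.finrank_pos_iff_exists_ne_zero.1 h2
  exact ⟨v, by simpa using hv, Submodule.mem_orthogonal_singleton_iff_inner_right.1 v.2⟩

/-- The squared distance of two feature vectors across the direction `u`. -/
noncomputable def crossDist (u : Feat p) (x y : Feat p) : ℝ := ‖stretch u 0 1 (x - y)‖ ^ 2

/-- Distances across `u` are almost surely distinct, so that nearest neighbours are unique. This
needs a direction orthogonal to `u`, hence `2 ≤ p`. -/
lemma ae_crossDist_ne (hp : 2 ≤ p) (hu : ‖u‖ = 1) {i j l : Fin N} (hji : j ≠ i)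
    (hjl : j ≠ l) :
    ∀ᵐ w : Fin N → Feat p, crossDist u (w i) (w j) ≠ crossDist u (w i) (w l) := by
  obtain ⟨v, hv, huv⟩ := exists_inner_eq_zero hp hu
  have key := ae_ne_zero_of_analytic_lines (volume : Measure (Fin N → Feat p))
    (f := fun w => crossDist u (w i) (w j) - crossDist u (w i) (w l)) (a := Pi.single j v)
    (by unfold crossDist; fun_prop) ?_ ?_
  · filter_upwards [key] with w hw
    exact sub_ne_zero.1 hw
  · by_cases hli : l = i
    · subst hli
      simp [crossDist, hjl.symm, stretch_apply, huv, hv]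
    · simp [crossDist, hjl.symm, hji.symm, stretch_apply, huv, hv]
  · intro z t _
    have h : ∀ (x y x' y' : Feat p), AnalyticAt ℝ
        (fun t : ℝ => crossDist u (x + t • x') (y + t • y')) t := by
      intro x y x' y'
      have e : ∀ t : ℝ, crossDist u (x + t • x') (y + t • y')
          = ‖stretch u 0 1 (x - y)‖ ^ 2 + 2 * (t * inner ℝ (stretch u 0 1 (x - y))
            (stretch u 0 1 (x' - y'))) + t ^ 2 * ‖stretch u 0 1 (x' - y')‖ ^ 2 := fun t => by
        rw [crossDist, show x + t • x' - (y + t • y') = (x - y) + t • (x' - y') by module,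
          map_add, map_smul, norm_add_sq_real, real_inner_smul_right, norm_smul, mul_pow,
          Real.norm_eq_abs, sq_abs]
      simp only [e]
      fun_prop
    exact (h _ _ _ _).sub (h _ _ _ _)

end Generic

/-! ### Absolute continuity of product measures -/

section AbsolutelyContinuous

lemma absolutelyContinuous_pi {n : ℕ} {X : Type*} [MeasurableSpace X] {μ ν : Measure X}
    [SigmaFinite μ] [SigmaFinite ν] (h : μ ≪ ν) :
    Measure.pi (fun _ : Fin n => μ) ≪ Measure.pi (fun _ : Fin n => ν) := by
  induction n with
  | zero => rw [Measure.pi_of_empty, Measure.pi_of_empty]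
  | succ n ih =>
    have h1 := (measurePreserving_piFinSuccAbove (fun _ : Fin (n + 1) => μ) 0).symm
    have h2 := (measurePreserving_piFinSuccAbove (fun _ : Fin (n + 1) => ν) 0).symm
    rw [← h1.map_eq, ← h2.map_eq]
    exact (h.prod ih).map h1.measurable

lemma quasiMeasurePreserving_pi {n : ℕ} {X Y : Type*} [MeasurableSpace X] [MeasurableSpace Y]
    {μ : Measure X} {ν : Measure Y} [IsFiniteMeasure μ] [SigmaFinite ν] {f : X → Y}
    (hf : Measure.QuasiMeasurePreserving f μ ν) :
    Measure.QuasiMeasurePreserving (fun (x : Fin n → X) i => f (x i))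
      (Measure.pi fun _ => μ) (Measure.pi fun _ => ν) := by
  refine ⟨measurable_pi_lambda _ fun i => hf.measurable.comp (measurable_pi_apply i), ?_⟩
  rw [Measure.pi_map_pi fun _ => hf.measurable.aemeasurable]
  exact absolutelyContinuous_pi hf.absolutelyContinuous

lemma stdGaussian_absolutelyContinuous (p : ℕ) :
    stdGaussian (Feat p) ≪ (volume : Measure (Feat p)) := by
  rw [← map_pi_eq_stdGaussian, ← (PiLp.volume_preserving_toLp (Fin p)).map_eq]
  exact (absolutelyContinuous_pi
    (gaussianReal_absolutelyContinuous 0 one_ne_zero)).map (by fun_prop)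

lemma ae_goodRatio {α : ℝ} : ∀ᵐ r ∂betaMeasure α α, GoodRatio r := by
  have h1 : ∀ᵐ r ∂betaMeasure α α, r ≠ 1 / 2 := by
    have : ∀ᵐ r : ℝ, r ≠ 1 / 2 := by simp [ae_iff]
    exact (withDensity_absolutelyContinuous _ _).ae_le this
  have hm : Measurable (betaPDF α α) := (measurable_betaPDFReal α α).ennreal_ofReal
  have h2 : ∀ᵐ r ∂betaMeasure α α, betaPDF α α r ≠ 0 := by
    rw [betaMeasure, ae_withDensity_iff hm]
    exact Eventually.of_forall fun _ h => h
  filter_upwards [h1, h2] with r hr hr'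
  refine ⟨?_, ?_, hr⟩
  · by_contra h
    exact hr' (betaPDF_eq_zero_of_nonpos (not_lt.1 h))
  · by_contra h
    exact hr' (betaPDF_eq_zero_of_one_le (not_lt.1 h))

end AbsolutelyContinuous

/-! ### A measurable event that contains the failures -/

section Failure

variable {p N : ℕ}

/-- The event that one of the least squares problems is degenerate, or that C-Mixup does not win
with the explicit least squares solutions. -/
def failureEvent (P : Measure (Feat p × ℝ)) (h : ℝ) : Set (Sample p N) :=
  {ω | ¬ ((FullRank (mixed ω.1 ω.2.1) ∧ FullRank (mixed ω.1 ω.2.2.1) ∧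
      FullRank (mixed ω.1 ω.2.2.2)) ∧
    mse P boxKernel h (mixed ω.1 ω.2.1) (lsSol (mixed ω.1 ω.2.1))
      < mse P boxKernel h (mixed ω.1 ω.2.2.1) (lsSol (mixed ω.1 ω.2.2.1)) ∧
    mse P boxKernel h (mixed ω.1 ω.2.1) (lsSol (mixed ω.1 ω.2.1))
      < mse P boxKernel h (mixed ω.1 ω.2.2.2) (lsSol (mixed ω.1 ω.2.2.2)))}

lemma subset_failureEvent (P : Measure (Feat p × ℝ)) (h : ℝ) :
    {ω : Sample p N | ¬ CMixupWins P boxKernel h ω} ⊆ failureEvent P h := by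
  intro ω hω hgood
  obtain ⟨⟨hC, hF, hV⟩, h1, h2⟩ := hgood
  refine hω fun bC bF bV lC lF lV => ?_
  rw [lC.eq_lsSol hC, lF.eq_lsSol hF, lV.eq_lsSol hV]
  exact lt_min h1 h2

lemma measurable_mse_lsSol {X : Type*} [MeasurableSpace X] (P : Measure (Feat p × ℝ)) [SFinite P]
    (h : ℝ) {T : X → Fin N → Feat p × ℝ} (hT : Measurable T) :
    Measurable fun x => mse P boxKernel h (T x) (lsSol (T x)) := by
  unfold mse
  refine Measurable.lintegral_prod_right' (f := fun q : X × (Feat p × ℝ) => ENNReal.ofReal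
    ((q.2.2 - kernelEstimator boxKernel h (T q.1) (lsSol (T q.1))
      (inner ℝ (lsSol (T q.1)) q.2.1)) ^ 2)) ?_
  have hT' : Measurable fun q : X × (Feat p × ℝ) => T q.1 := hT.comp measurable_fst
  have hb : Measurable fun q : X × (Feat p × ℝ) => lsSol (T q.1) := measurable_lsSol.comp hT'
  have := measurable_kernelEstimator measurable_boxKernel h hT' hb
    (hb.inner (𝕜 := ℝ) (by fun_prop : Measurable fun q : X × (Feat p × ℝ) => q.2.1))
  fun_prop

lemma measurableSet_failureEvent (P : Measure (Feat p × ℝ)) [SFinite P] (h : ℝ) :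
    MeasurableSet (failureEvent P h : Set (Sample p N)) := by
  have m1 : Measurable fun ω : Sample p N => mixed ω.1 ω.2.1 :=
    measurable_mixed (by fun_prop) (by fun_prop)
  have m2 : Measurable fun ω : Sample p N => mixed ω.1 ω.2.2.1 :=
    measurable_mixed (by fun_prop) (by fun_prop)
  have m3 : Measurable fun ω : Sample p N => mixed ω.1 ω.2.2.2 :=
    measurable_mixed (by fun_prop) (by fun_prop)
  refine MeasurableSet.compl ?_
  refine ((measurableSet_fullRank.preimage m1).inter
    ((measurableSet_fullRank.preimage m2).inter (measurableSet_fullRank.preimage m3))).inter ?_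
  exact (measurableSet_lt (measurable_mse_lsSol P h m1) (measurable_mse_lsSol P h m2)).inter
    (measurableSet_lt (measurable_mse_lsSol P h m1) (measurable_mse_lsSol P h m3))

end Failure

/-! ### The limit of large scales, for given latent variables -/

section Pointwise

variable {p N : ℕ} {g : ℝ → ℝ} {c₀ c₁ : ℝ} {θ : Feat p}

/-- The training data at stage `n`, as a function of the clusters and of the latent variables. -/
noncomputable def rawData (g : ℝ → ℝ) (θ : Feat p) (n : ℕ)
    (s : (Fin N → Fin 2) × (Fin N → Latent p)) : Fin N → Feat p × ℝ :=
  fun i => rawObs g θ n (s.1 i, s.2 i)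

/-- The limit of the normalised augmented data. -/
noncomputable def limMixed (θ : Feat p) (s : (Fin N → Fin 2) × (Fin N → Latent p))
    (A : Choices N) : Fin N → Feat p × ℝ :=
  mixed (limData (‖θ‖⁻¹ • θ) s.1 fun i => (s.2 i).1) A

lemma FullRank.of_normalise {u : Feat p} (hu : ‖u‖ = 1) {n : ℕ} {H : ℝ} (hH : 0 < H)
    {T : Fin N → Feat p × ℝ} (h : FullRank fun i => normObs u n H (T i)) : FullRank T := by
  intro c hc
  have h0 : normCoef u n H c = 0 := h _ fun i => by rw [inner_normCoef hu, hc i, zero_div]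
  have hs : scale n ≠ 0 := (scale_pos n).ne'
  have h1 : stretch u (scale n)⁻¹ (scale n ^ 2)⁻¹ (H • normCoef u n H c) = c := by
    rw [normCoef, smul_smul, mul_inv_cancel₀ hH.ne', one_smul, stretch_stretch hu,
      inv_mul_cancel₀ hs, inv_mul_cancel₀ (pow_ne_zero 2 hs), stretch_one_one]
  rw [← h1, h0, smul_zero, map_zero]

lemma tendsto_mixed_normObs (hg : IsLink g c₀ c₁) (hθ : θ ≠ 0)
    (s : (Fin N → Fin 2) × (Fin N → Latent p)) (A : Choices N) :
    Tendsto (fun n => fun i => normObs (‖θ‖⁻¹ • θ) n (labelUnit g θ n)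
      (mixed (rawData g θ n s) A i)) atTop (𝓝 (limMixed θ s A)) := by
  refine Tendsto.congr (fun n => mixed_normObs _ n _ (rawData g θ n s) A) ?_
  refine tendsto_pi_nhds.2 fun i => ?_
  have h : ∀ j, Tendsto (fun n => normObs (‖θ‖⁻¹ • θ) n (labelUnit g θ n)
      (rawData g θ n s j)) atTop (𝓝 (limData (‖θ‖⁻¹ • θ) s.1 (fun i => (s.2 i).1) j)) :=
    fun j => tendsto_normObs hg hθ (s.1 j, s.2 j)
  exact ((h i).const_smul (A i).2).add ((h (A i).1).const_smul (1 - (A i).2))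

lemma memLp_label_bound (ξLaw : Measure (Feat p)) (εLaw : Measure ℝ) [IsProbabilityMeasure ξLaw]
    [IsProbabilityMeasure εLaw] (hε : MemLp (fun e : ℝ => e) 2 εLaw) (u : Feat p) (a b : ℝ) :
    MemLp (fun q : Fin 2 × Latent p => a + b * (‖θ‖ * |inner ℝ u q.2.1|) + |q.2.2.2|) 2
      (clusterLaw.prod (latentLaw ξLaw εLaw)) := by
  have h1 : MemLp (fun q : Fin 2 × Latent p => inner ℝ u q.2.1) 2
      (clusterLaw.prod (latentLaw ξLaw εLaw)) := by
    have hG : MemLp (fun w : Feat p => inner ℝ u w) 2 (stdGaussian (Feat p)) :=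
      (innerSL ℝ u).comp_memLp' IsGaussian.memLp_two_id
    have hmp : MeasurePreserving (fun q : Fin 2 × Latent p => q.2.1)
        (clusterLaw.prod (latentLaw ξLaw εLaw)) (stdGaussian (Feat p)) :=
      (measurePreserving_fst (μ := stdGaussian (Feat p)) (ν := ξLaw.prod εLaw)).comp
        (measurePreserving_snd (μ := clusterLaw) (ν := latentLaw ξLaw εLaw))
    exact hG.comp_measurePreserving hmp
  have h2 : MemLp (fun q : Fin 2 × Latent p => q.2.2.2) 2
      (clusterLaw.prod (latentLaw ξLaw εLaw)) := by
    have hmp : MeasurePreserving (fun q : Fin 2 × Latent p => q.2.2.2)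
        (clusterLaw.prod (latentLaw ξLaw εLaw)) εLaw :=
      ((measurePreserving_snd (μ := ξLaw) (ν := εLaw)).comp
        (measurePreserving_snd (μ := stdGaussian (Feat p)) (ν := ξLaw.prod εLaw))).comp
        (measurePreserving_snd (μ := clusterLaw) (ν := latentLaw ξLaw εLaw))
    exact hε.comp_measurePreserving hmp
  exact ((memLp_const a).add ((h1.abs.const_mul ‖θ‖).const_mul b)).add h2.abs

/-- The errors of the normalised estimators converge to the error of the limiting one. -/
lemma tendsto_mse_normalised (hg : IsLink g c₀ c₁) (hθ : θ ≠ 0) (ξLaw : Measure (Feat p))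
    (εLaw : Measure ℝ) [IsProbabilityMeasure ξLaw] [IsProbabilityMeasure εLaw]
    (hε : MemLp (fun e : ℝ => e) 2 εLaw) (s : (Fin N → Fin 2) × (Fin N → Latent p))
    {A : Choices N} (hA : ∀ i, GoodRatio (A i).2) (hrank : FullRank (limMixed θ s A)) :
    (∀ᶠ n in atTop, FullRank (mixed (rawData g θ n s) A)) ∧
    Tendsto (fun n => mse (((clusterLaw.prod (latentLaw ξLaw εLaw)).map (rawObs g θ n)).map
        (normObs (‖θ‖⁻¹ • θ) n (labelUnit g θ n))) boxKernel (1 / 2)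
        (fun i => normObs (‖θ‖⁻¹ • θ) n (labelUnit g θ n) (mixed (rawData g θ n s) A i))
        (normCoef (‖θ‖⁻¹ • θ) n (labelUnit g θ n) (lsSol (mixed (rawData g θ n s) A)))) atTop
      (𝓝 (mse ((clusterLaw.prod (latentLaw ξLaw εLaw)).map
        fun q => limObs (‖θ‖⁻¹ • θ) q.1 q.2.1) boxKernel (1 / 2) (limMixed θ s A)
        (‖θ‖⁻¹ • θ))) := by
  have hu : ‖‖θ‖⁻¹ • θ‖ = 1 := norm_smul_inv_norm (𝕜 := ℝ) hθ
  have hT := tendsto_mixed_normObs hg hθ s A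
  have hfull : ∀ᶠ n in atTop, FullRank (mixed (rawData g θ n s) A) := by
    filter_upwards [hrank.eventually hT] with n hn
    exact hn.of_normalise hu (labelUnit_pos g θ n)
  refine ⟨hfull, ?_⟩
  have hb : Tendsto (fun n => normCoef (‖θ‖⁻¹ • θ) n (labelUnit g θ n)
      (lsSol (mixed (rawData g θ n s) A))) atTop (𝓝 (‖θ‖⁻¹ • θ)) := by
    refine tendsto_of_isLeastSquares hrank hT
      (fun i => (inner_mixed_limData hu _ _ A i).symm) ?_
    filter_upwards [hfull] with n hn
    exact (isLeastSquares_lsSol hn).normalise hu n (labelUnit_pos g θ n)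
  simp only [Measure.map_map (measurable_normObs _ _ _) (measurable_rawObs hg.measurable θ _)]
  refine tendsto_mse (fun n => (measurable_normObs _ _ _).comp
    (measurable_rawObs hg.measurable θ _)) (measurable_limObs _) (fun q => tendsto_normObs hg hθ q)
    (memLp_label_bound ξLaw εLaw hε (‖θ‖⁻¹ • θ) (|g 0| + 1) c₁)
    (fun n q => abs_normObs_snd_le hg hθ n q) hT hb ?_
  exact fun i q => mixed_limData_no_ties hu _ _ hA i q.1 q.2.1

/-- If C-Mixup mixes within the clusters and the two other procedures do not, then C-Mixup wins
at large scales. -/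
lemma eventually_notMem_failureEvent (hg : IsLink g c₀ c₁) (hθ : θ ≠ 0) (ξLaw : Measure (Feat p))
    (εLaw : Measure ℝ) [IsProbabilityMeasure ξLaw] [IsProbabilityMeasure εLaw]
    (hε : MemLp (fun e : ℝ => e) 2 εLaw) (s : (Fin N → Fin 2) × (Fin N → Latent p))
    {AC AF AV : Choices N} (hAC : ∀ i, GoodRatio (AC i).2) (hAF : ∀ i, GoodRatio (AF i).2)
    (hAV : ∀ i, GoodRatio (AV i).2) (hrC : FullRank (limMixed θ s AC))
    (hrF : FullRank (limMixed θ s AF)) (hrV : FullRank (limMixed θ s AV))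
    (hC : ∀ i, s.1 (AC i).1 = s.1 i) (hF : ∃ i, s.1 (AF i).1 ≠ s.1 i)
    (hV : ∃ i, s.1 (AV i).1 ≠ s.1 i) :
    ∀ᶠ n in atTop, ((rawData g θ n s, AC, AF, AV) : Sample p N) ∉
      failureEvent ((clusterLaw.prod (latentLaw ξLaw εLaw)).map (rawObs g θ n))
        (labelUnit g θ n * (1 / 2)) := by
  have hu : ‖‖θ‖⁻¹ • θ‖ = 1 := norm_smul_inv_norm (𝕜 := ℝ) hθ
  obtain ⟨eC, tC⟩ := tendsto_mse_normalised hg hθ ξLaw εLaw hε s hAC hrC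
  obtain ⟨eF, tF⟩ := tendsto_mse_normalised hg hθ ξLaw εLaw hε s hAF hrF
  obtain ⟨eV, tV⟩ := tendsto_mse_normalised hg hθ ξLaw εLaw hε s hAV hrV
  obtain ⟨iF, hiF⟩ := hF
  obtain ⟨iV, hiV⟩ := hV
  have hk : ∀ c, ∃ i, s.1 i = c := fun c => by
    have h2 : ∀ a b c : Fin 2, a ≠ b → a = c ∨ b = c := by decide
    rcases h2 _ _ c hiV with h | h
    · exact ⟨_, h⟩
    · exact ⟨_, h⟩
  have zC := mse_limit_eq_zero (clusterLaw.prod (latentLaw ξLaw εLaw)) hu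
    (fun i => (s.2 i).1) hk hC
  have pF := mse_limit_pos (latentLaw ξLaw εLaw) hu (fun i => (s.2 i).1) hAF hiF
  have pV := mse_limit_pos (latentLaw ξLaw εLaw) hu (fun i => (s.2 i).1) hAV hiV
  rw [limMixed, zC] at tC
  filter_upwards [eC, eF, eV, tC.eventually_lt tF pF, tC.eventually_lt tV pV]
    with n h1 h2 h3 h4 h5 hfail
  refine hfail ⟨⟨h1, h2, h3⟩, ?_, ?_⟩
  · rw [mse_normalise hu n (labelUnit_pos g θ n) _ measurable_boxKernel,
      mse_normalise hu n (labelUnit_pos g θ n) _ measurable_boxKernel]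
    exact ENNReal.mul_lt_mul_right (by simpa using (labelUnit_pos g θ n).ne')
      ENNReal.ofReal_ne_top h4
  · rw [mse_normalise hu n (labelUnit_pos g θ n) _ measurable_boxKernel,
      mse_normalise hu n (labelUnit_pos g θ n) _ measurable_boxKernel]
    exact ENNReal.mul_lt_mul_right (by simpa using (labelUnit_pos g θ n).ne')
      ENNReal.ofReal_ne_top h5

/-- C-Mixup does not mix different clusters at large scales, if every example has company in its
cluster. -/
lemma tendsto_choicesDensity_label (hg : IsLink g c₀ c₁) (hθ : θ ≠ 0) {σ : ℝ} (hσ : 0 < σ)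
    (s : (Fin N → Fin 2) × (Fin N → Latent p)) (hs : ∀ i, ∃ j, j ≠ i ∧ s.1 j = s.1 i)
    {A : Choices N} {i : Fin N} (hA : s.1 (A i).1 ≠ s.1 i) :
    Tendsto (fun n => choicesDensity distLabel σ (rawData g θ n s) A) atTop (𝓝 0) := by
  obtain ⟨l, hl, hli⟩ := hs i
  refine tendsto_choicesDensity distLabel hσ hl ?_
  have hH := tendsto_labelUnit hg hθ
  have hy : ∀ j, Tendsto (fun n => (rawData g θ n s j).2 / labelUnit g θ n) atTop
      (𝓝 (lab (s.1 j))) := fun j => (tendsto_normObs hg hθ (s.1 j, s.2 j)).snd_nhds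
  have hne : 0 < (lab (s.1 i) - lab (s.1 (A i).1)) ^ 2 :=
    sq_pos_of_ne_zero (sub_ne_zero.2 fun h => hA (lab_injective h.symm))
  have h1 : Tendsto (fun n => ((rawData g θ n s i).2 - (rawData g θ n s (A i).1).2) ^ 2) atTop
      atTop := by
    have h2 := (((hy i).sub (hy (A i).1)).pow 2).pos_mul_atTop hne
      ((tendsto_pow_atTop two_ne_zero).comp hH)
    refine h2.congr fun n => ?_
    have := (labelUnit_pos g θ n).ne'
    simp only [Function.comp]
    field_simp
  have h3 : ∀ n, ((rawData g θ n s i).2 - (rawData g θ n s l).2) ^ 2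
      ≤ (c₁ * (‖θ‖ * |inner ℝ (‖θ‖⁻¹ • θ) (s.2 i).1|)
        + c₁ * (‖θ‖ * |inner ℝ (‖θ‖⁻¹ • θ) (s.2 l).1|) + |(s.2 i).2.2 - (s.2 l).2.2|) ^ 2 := by
    intro n
    have hi := abs_link_signal_sub_le hg hθ n (s.1 i, s.2 i)
    have hl' := abs_link_signal_sub_le hg hθ n (s.1 l, s.2 l)
    simp only [hli] at hi hl'
    rw [← sq_abs]
    refine pow_le_pow_left₀ (abs_nonneg _) ?_ 2
    simp only [rawData, rawObs]
    rw [hli]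
    set a := g (inner ℝ θ (signal (‖θ‖⁻¹ • θ) n (s.1 i, s.2 i)))
    set b := g (inner ℝ θ (signal (‖θ‖⁻¹ • θ) n (s.1 i, s.2 l)))
    set c := g (‖θ‖ * (scale n * lab (s.1 i)))
    rw [show a + (s.2 i).2.2 - (b + (s.2 l).2.2) = (a - c - (b - c))
      + ((s.2 i).2.2 - (s.2 l).2.2) by ring]
    exact (abs_add_le _ _).trans (add_le_add_left ((abs_sub _ _).trans (add_le_add hi hl')) _)
  refine tendsto_atTop_mono (fun n => sub_le_sub_left (h3 n) _) ?_
  exact tendsto_atTop_add_const_right _ _ h1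

/-- Mixup with feature similarity mixes nearest neighbours across the signal direction, at large
scales. -/
lemma tendsto_choicesDensity_feat {σ : ℝ} (hσ : 0 < σ)
    (hθ : θ ≠ 0) (s : (Fin N → Fin 2) × (Fin N → Latent p)) {A : Choices N} {i l : Fin N}
    (hl : l ≠ i) (hA : crossDist (‖θ‖⁻¹ • θ) (s.2 i).1 (s.2 l).1
      < crossDist (‖θ‖⁻¹ • θ) (s.2 i).1 (s.2 (A i).1).1) :
    Tendsto (fun n => choicesDensity distFeat σ (rawData g θ n s) A) atTop (𝓝 0) := by
  refine tendsto_choicesDensity distFeat hσ hl ?_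
  have hu : ‖‖θ‖⁻¹ • θ‖ = 1 := norm_smul_inv_norm (𝕜 := ℝ) hθ
  set u := ‖θ‖⁻¹ • θ
  have hs : ∀ n, scale n ≠ 0 := fun n => (scale_pos n).ne'
  have h2 : Tendsto (fun n => (scale n ^ 2)⁻¹) atTop (𝓝 0) := by
    simpa using tendsto_scale_inv.pow 2
  have hx : ∀ j, Tendsto (fun n => (scale n ^ 2)⁻¹ • (rawData g θ n s j).1) atTop
      (𝓝 (stretch u 0 1 (s.2 j).1)) := by
    intro j
    have e : ∀ n, (scale n ^ 2)⁻¹ • (rawData g θ n s j).1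
        = ((scale n)⁻¹ * lab (s.1 j)) • u + ((s.2 j).1 + (((scale n ^ 2)⁻¹ - 1)
          * inner ℝ u (s.2 j).1) • u) + (scale n ^ 2)⁻¹ • (s.2 j).2.1 := fun n => by
      have hfold : ‖θ‖⁻¹ • θ = u := rfl
      have := hs n
      simp only [rawData, rawObs, signal]
      rw [hfold]
      clear_value u
      simp only [stretch_apply, smul_add, smul_smul]
      congr 2
      · congr 1; field_simp
      · rw [inv_mul_cancel₀ (pow_ne_zero 2 this), one_smul]
        congr 2; field_simp
    simp only [e]
    have h3 := (((tendsto_scale_inv.mul_const (lab (s.1 j))).smul_const u).add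
      (((((h2.sub_const 1).mul_const (inner ℝ u (s.2 j).1)).smul_const u).const_add
        (s.2 j).1))).add (h2.smul_const (s.2 j).2.1)
    simpa [stretch_apply] using h3
  have hd : ∀ j, Tendsto (fun n => ‖(scale n ^ 2)⁻¹ • (rawData g θ n s i).1
      - (scale n ^ 2)⁻¹ • (rawData g θ n s j).1‖ ^ 2) atTop
      (𝓝 (crossDist u (s.2 i).1 (s.2 j).1)) := fun j => by
    rw [crossDist, map_sub]
    exact ((hx i).sub (hx j)).norm.pow 2
  have h4 : Tendsto (fun n => (scale n ^ 2) ^ 2) atTop atTop :=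
    (tendsto_pow_atTop two_ne_zero).comp ((tendsto_pow_atTop two_ne_zero).comp tendsto_scale)
  have h5 := ((hd (A i).1).sub (hd l)).pos_mul_atTop (sub_pos.2 hA) h4
  refine h5.congr fun n => ?_
  have := hs n
  simp only [distFeat, ← smul_sub, norm_smul, mul_pow, norm_inv, Real.norm_eq_abs, inv_pow, sq_abs]
  field_simp

end Pointwise

/-! ### The experiment on a common probability space -/

section Experiment

variable {p N : ℕ}

/-- The clusters and the latent variables of the training examples. -/
abbrev Sources (p N : ℕ) : Type := (Fin N → Fin 2) × (Fin N → Latent p)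

/-- The law of the clusters and of the latent variables of `N` i.i.d. training examples. -/
noncomputable def sourcesLaw (ρ : Measure (Latent p)) (N : ℕ) : Measure (Sources p N) :=
  (Measure.pi fun _ : Fin N => clusterLaw).prod (Measure.pi fun _ : Fin N => ρ)

instance (ρ : Measure (Latent p)) [IsProbabilityMeasure ρ] :
    IsProbabilityMeasure (sourcesLaw ρ N) := by
  unfold sourcesLaw; infer_instance

/-- The reference measure on the choices of the three procedures. -/
noncomputable abbrev choicesRef₃ (α : ℝ) (N : ℕ) :
    Measure (Choices N × Choices N × Choices N) :=
  (choicesRef α N).prod ((choicesRef α N).prod (choicesRef α N))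

lemma isFiniteMeasure_choicesRef {α : ℝ} (hα : 0 < α) (N : ℕ) :
    IsFiniteMeasure (choicesRef α N) := by
  have := isProbabilityMeasureBeta hα hα
  unfold choicesRef; infer_instance

@[fun_prop]
lemma measurable_rawData {g : ℝ → ℝ} (hg : Measurable g) (θ : Feat p) (n : ℕ) :
    Measurable (rawData g θ n : Sources p N → Fin N → Feat p × ℝ) := by
  unfold rawData
  exact measurable_pi_lambda _ fun i => (measurable_rawObs hg θ n).comp (by fun_prop)

lemma pi_map_rawObs {g : ℝ → ℝ} (hg : Measurable g) (θ : Feat p) (n : ℕ)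
    (ρ : Measure (Latent p)) [IsProbabilityMeasure ρ] :
    (Measure.pi fun _ : Fin N => (clusterLaw.prod ρ).map (rawObs g θ n))
      = (sourcesLaw ρ N).map (rawData g θ n) := by
  have hm := measurable_rawObs hg θ n
  have : IsProbabilityMeasure ((clusterLaw.prod ρ).map (rawObs g θ n)) :=
    Measure.isProbabilityMeasure_map hm.aemeasurable
  rw [← Measure.pi_map_pi (μ := fun _ : Fin N => clusterLaw.prod ρ) fun _ => hm.aemeasurable]
  have h := (measurePreserving_arrowProdEquivProdArrow (Fin 2) (Latent p) (Fin N)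
    (fun _ => clusterLaw) (fun _ => ρ)).symm
  rw [← h.map_eq, Measure.map_map (by fun_prop) h.measurable]
  rfl

/-- The density of the choices of the three procedures, given the training data. -/
noncomputable def totalDensity (σy σx : ℝ) (D : Fin N → Feat p × ℝ)
    (A : Choices N × Choices N × Choices N) : ℝ≥0∞ :=
  choicesDensity distLabel σy D A.1 *
    (choicesDensity distFeat σx D A.2.1 * choicesDensity distVanilla 1 D A.2.2)

lemma totalDensity_le_one (σy σx : ℝ) (D : Fin N → Feat p × ℝ)
    (A : Choices N × Choices N × Choices N) : totalDensity σy σx D A ≤ 1 :=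
  mul_le_one' (choicesDensity_le_one _ _ _ _)
    (mul_le_one' (choicesDensity_le_one _ _ _ _) (choicesDensity_le_one _ _ _ _))

lemma totalDensity_le_label (σy σx : ℝ) (D : Fin N → Feat p × ℝ)
    (A : Choices N × Choices N × Choices N) :
    totalDensity σy σx D A ≤ choicesDensity distLabel σy D A.1 :=
  mul_le_of_le_one_right' (mul_le_one' (choicesDensity_le_one _ _ _ _)
    (choicesDensity_le_one _ _ _ _))

lemma totalDensity_le_feat (σy σx : ℝ) (D : Fin N → Feat p × ℝ)
    (A : Choices N × Choices N × Choices N) :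
    totalDensity σy σx D A ≤ choicesDensity distFeat σx D A.2.1 :=
  (mul_le_of_le_one_left' (choicesDensity_le_one _ _ _ _)).trans
    (mul_le_of_le_one_right' (choicesDensity_le_one _ _ _ _))

lemma measurable_distLabel :
    Measurable fun q : (Feat p × ℝ) × (Feat p × ℝ) => distLabel q.1 q.2 := by
  unfold distLabel; fun_prop

lemma measurable_distFeat :
    Measurable fun q : (Feat p × ℝ) × (Feat p × ℝ) => distFeat q.1 q.2 := by
  unfold distFeat; fun_prop

lemma measurable_distVanilla :
    Measurable fun q : (Feat p × ℝ) × (Feat p × ℝ) => distVanilla q.1 q.2 := by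
  unfold distVanilla; fun_prop

lemma measurable_totalDensity (σy σx : ℝ) :
    Measurable fun ω : Sample p N => totalDensity σy σx ω.1 ω.2 := by
  unfold totalDensity
  exact (measurable_choicesDensity _ _ measurable_distLabel (by fun_prop) (by fun_prop)).mul
    ((measurable_choicesDensity _ _ measurable_distFeat (by fun_prop) (by fun_prop)).mul
      (measurable_choicesDensity _ _ measurable_distVanilla (by fun_prop) (by fun_prop)))

lemma measurable_prodMk_rawData {g : ℝ → ℝ} (hg : Measurable g) (θ : Feat p) (n : ℕ) :
    Measurable fun q : Sources p N × Choices N × Choices N × Choices N =>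
      ((rawData g θ n q.1, q.2) : Sample p N) := by
  have h : Measurable fun q : Sources p N × Choices N × Choices N × Choices N =>
      rawData g θ n q.1 := (measurable_rawData hg θ n).comp measurable_fst
  exact h.prodMk measurable_snd

lemma measurable_totalDensity_rawData {g : ℝ → ℝ} (hg : Measurable g) (θ : Feat p) (n : ℕ)
    (σy σx : ℝ) :
    Measurable fun q : Sources p N × Choices N × Choices N × Choices N =>
      totalDensity σy σx (rawData g θ n q.1) q.2 := by
  have h := (measurable_totalDensity (p := p) (N := N) σy σx).comp
    (measurable_prodMk_rawData hg θ n)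
  exact h

/-- A weighted integral over the choices of the three procedures is at most the weighted integral
over those of vanilla mixup, if the integrand involves only the latter. -/
lemma lintegral_totalDensity_le {α : ℝ} (hα : 0 < α) (σy σx : ℝ) (D : Fin N → Feat p × ℝ)
    {f : Choices N → ℝ≥0∞} (hf : Measurable f) :
    ∫⁻ A, totalDensity σy σx D A * f A.2.2 ∂choicesRef₃ α N
      ≤ ∫⁻ B, choicesDensity distVanilla 1 D B * f B ∂choicesRef α N := by
  have := isFiniteMeasure_choicesRef hα N
  have hC : Measurable (choicesDensity (N := N) (distLabel (p := p)) σy D) :=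
    measurable_choicesDensity _ _ measurable_distLabel measurable_const measurable_id
  have hF : Measurable (choicesDensity (N := N) (distFeat (p := p)) σx D) :=
    measurable_choicesDensity _ _ measurable_distFeat measurable_const measurable_id
  have hV : Measurable (choicesDensity (N := N) (distVanilla (p := p)) 1 D) :=
    measurable_choicesDensity _ _ measurable_distVanilla measurable_const measurable_id
  simp only [totalDensity, mul_assoc]
  rw [lintegral_prod_mul (f := choicesDensity distLabel σy D)
    (g := fun A : Choices N × Choices N => choicesDensity distFeat σx D A.1
      * (choicesDensity distVanilla 1 D A.2 * f A.2)) hC.aemeasurable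
      (by fun_prop),
    lintegral_prod_mul (f := choicesDensity distFeat σx D)
    (g := fun A : Choices N => choicesDensity distVanilla 1 D A * f A) hF.aemeasurable
      (hV.mul hf).aemeasurable]
  refine (mul_le_of_le_one_left' (lintegral_choicesDensity_le_one _ _ hα D)).trans ?_
  exact mul_le_of_le_one_left' (lintegral_choicesDensity_le_one _ _ hα D)

lemma lintegral_totalDensity_le_one {α : ℝ} (hα : 0 < α) (σy σx : ℝ)
    (D : Fin N → Feat p × ℝ) : ∫⁻ A, totalDensity σy σx D A ∂choicesRef₃ α N ≤ 1 := by
  have := lintegral_totalDensity_le hα σy σx D (f := fun _ => 1) measurable_const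
  simp only [mul_one] at this
  exact this.trans (lintegral_choicesDensity_le_one _ _ hα D)

/-- Probabilities of the experiment as integrals over the sources of randomness. -/
lemma sampleLaw_map_apply {g : ℝ → ℝ} (hg : Measurable g) (θ : Feat p) (n : ℕ)
    (ρ : Measure (Latent p)) [IsProbabilityMeasure ρ] {α : ℝ} (hα : 0 < α) (σy σx : ℝ)
    {B : Set (Sample p N)} (hB : MeasurableSet B) :
    sampleLaw ((clusterLaw.prod ρ).map (rawObs g θ n)) α σy σx N B
      = ∫⁻ q, B.indicator (fun ω => totalDensity σy σx ω.1 ω.2) (rawData g θ n q.1, q.2)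
        ∂(sourcesLaw ρ N).prod (choicesRef₃ α N) := by
  have := isFiniteMeasure_choicesRef hα N
  have hm : Measurable (rawData g θ n : Sources p N → Fin N → Feat p × ℝ) :=
    measurable_rawData hg θ n
  have e : ((sourcesLaw ρ N).map (rawData g θ n)).prod (choicesRef₃ α N)
      = ((sourcesLaw ρ N).prod (choicesRef₃ α N)).map (Prod.map (rawData g θ n) id) := by
    conv_lhs => rw [← Measure.map_id (μ := choicesRef₃ α N)]
    exact Measure.map_prod_map _ _ hm measurable_id
  rw [sampleLaw, withDensity_apply _ hB, ← lintegral_indicator hB, pi_map_rawObs hg, e]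
  change ∫⁻ ω, B.indicator (fun ω => totalDensity σy σx ω.1 ω.2) ω ∂_ = _
  rw [lintegral_map ((measurable_totalDensity σy σx).indicator hB) (hm.prodMap measurable_id)]
  rfl

end Experiment

/-! ### Almost sure properties of the limit -/

section AlmostSure

variable {p N : ℕ}

lemma quasiMeasurePreserving_latentLaw (ξLaw : Measure (Feat p)) (εLaw : Measure ℝ)
    [IsProbabilityMeasure ξLaw] [IsProbabilityMeasure εLaw] :
    Measure.QuasiMeasurePreserving (fun r : Latent p => r.1) (latentLaw ξLaw εLaw) volume :=
  Measure.quasiMeasurePreserving_fst.mono_right (stdGaussian_absolutelyContinuous p)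

lemma quasiMeasurePreserving_ratios {α : ℝ} (hα : 0 < α) (N : ℕ) :
    Measure.QuasiMeasurePreserving (fun (A : Choices N) i => (A i).2) (choicesRef α N)
      volume := by
  have := isProbabilityMeasureBeta hα hα
  exact quasiMeasurePreserving_pi (f := fun a : Fin N × ℝ => a.2)
    (Measure.quasiMeasurePreserving_snd.mono_right (withDensity_absolutelyContinuous _ _))

lemma ae_choicesRef_goodRatio {α : ℝ} (hα : 0 < α) (N : ℕ) :
    ∀ᵐ A ∂choicesRef α N, ∀ i, GoodRatio (A i).2 := by
  have := isProbabilityMeasureBeta hα hα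
  refine ae_all_iff.2 fun i => ?_
  exact (Measure.quasiMeasurePreserving_snd.comp (Measure.quasiMeasurePreserving_eval
    (fun _ : Fin N => (Measure.count : Measure (Fin N)).prod (betaMeasure α α)) i)).ae
      ae_goodRatio

lemma ae_fullRank_limMixed {θ : Feat p} (hN : p + 1 ≤ N)
    (ξLaw : Measure (Feat p)) (εLaw : Measure ℝ) [IsProbabilityMeasure ξLaw]
    [IsProbabilityMeasure εLaw] {α : ℝ} (hα : 0 < α) :
    ∀ᵐ q ∂(sourcesLaw (latentLaw ξLaw εLaw) N).prod (choicesRef α N),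
      (∃ i, q.1.1 i = 1) → FullRank (limMixed θ q.1 q.2) := by
  have := isFiniteMeasure_choicesRef hα N
  have hq : Measure.QuasiMeasurePreserving
      (Prod.map (fun (s : Sources p N) i => (s.2 i).1) (fun (A : Choices N) i => (A i).2))
      ((sourcesLaw (latentLaw ξLaw εLaw) N).prod (choicesRef α N))
      ((volume : Measure (Fin N → Feat p)).prod (volume : Measure (Fin N → ℝ))) :=
    MeasureTheory.QuasiMeasurePreserving.prodMap
      ((quasiMeasurePreserving_pi (quasiMeasurePreserving_latentLaw ξLaw εLaw)).comp
        Measure.quasiMeasurePreserving_snd) (quasiMeasurePreserving_ratios hα N)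
  have h : ∀ (k : Fin N → Fin 2) (π : Fin N → Fin N), (∃ i, k i = 1) →
      ∀ᵐ q ∂(sourcesLaw (latentLaw ξLaw εLaw) N).prod (choicesRef α N),
        FullRank (mixed (limData (‖θ‖⁻¹ • θ) k fun i => (q.1.2 i).1)
          fun i => (π i, (q.2 i).2)) := by
    rintro k π ⟨i, hi⟩
    exact hq.ae (ae_fullRank_limData (u := ‖θ‖⁻¹ • θ) hN hi π)
  have h' := ae_all_iff.2 fun k => ae_all_iff.2 fun π => eventually_imp_distrib_left.2 (h k π)
  filter_upwards [h'] with q hq hi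
  exact hq q.1.1 (fun i => (q.2 i).1) hi

end AlmostSure

/-! ### The exceptional events -/

section Exceptional

variable {p N : ℕ}

lemma measurableSet_forall {X ι : Type*} [MeasurableSpace X] [Countable ι] {P : ι → X → Prop}
    (h : ∀ i, MeasurableSet {x | P i x}) : MeasurableSet {x | ∀ i, P i x} := by
  have e : {x | ∀ i, P i x} = ⋂ i, {x | P i x} := by ext; simp
  rw [e]
  exact MeasurableSet.iInter h

/-- The event that some example is alone in its cluster. -/
def lonelyEvent (p N : ℕ) : Set (Sources p N) := {s | ∃ i, ∀ j, j ≠ i → s.1 j ≠ s.1 i}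

/-- The event that all nearest neighbours across the signal direction are in the same cluster. -/
def neighbourEvent (u : Feat p) (N : ℕ) : Set (Sources p N) :=
  {s | ∃ π : Fin N → Fin N, (∀ i, π i ≠ i) ∧
    (∀ i l, l ≠ i → crossDist u (s.2 i).1 (s.2 (π i)).1 ≤ crossDist u (s.2 i).1 (s.2 l).1) ∧
    ∀ i, s.1 (π i) = s.1 i}

lemma measurableSet_lonelyEvent : MeasurableSet (lonelyEvent p N) :=
  (Set.toFinite {k : Fin N → Fin 2 | ∃ i, ∀ j, j ≠ i → k j ≠ k i}).measurableSet.preimage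
    measurable_fst

lemma measurableSet_neighbourEvent (u : Feat p) : MeasurableSet (neighbourEvent u N) := by
  have e : neighbourEvent u N = ⋃ π : Fin N → Fin N, {s | (∀ i, π i ≠ i) ∧
    (∀ i l, l ≠ i → crossDist u (s.2 i).1 (s.2 (π i)).1 ≤ crossDist u (s.2 i).1 (s.2 l).1) ∧
    ∀ i, s.1 (π i) = s.1 i} := by
    ext s; simp [neighbourEvent]
  rw [e]
  refine MeasurableSet.iUnion fun π => ?_
  refine (MeasurableSet.const _).inter (MeasurableSet.inter ?_ ?_)
  · refine measurableSet_forall fun i => measurableSet_forall fun l =>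
      (MeasurableSet.const _).imp (measurableSet_le ?_ ?_) <;> (unfold crossDist; fun_prop)
  · exact measurableSet_forall fun i => measurableSet_eq_fun (by fun_prop) (by fun_prop)

lemma measure_lonelyEvent_le (ρ : Measure (Latent p)) [IsProbabilityMeasure ρ] :
    sourcesLaw ρ N (lonelyEvent p N) ≤ (N * 2 : ℕ) * (2 ^ N : ℝ≥0∞)⁻¹ := by
  have e : lonelyEvent p N = {k : Fin N → Fin 2 | ∃ i, ∀ j, j ≠ i → k j ≠ k i} ×ˢ Set.univ := by
    ext s; simp [lonelyEvent]
  rw [e, sourcesLaw, Measure.prod_prod, measure_univ, mul_one]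
  exact measure_singleton_cluster_le

lemma measure_neighbourEvent_le (hp : 2 ≤ p) {u : Feat p} (hu : ‖u‖ = 1)
    (ξLaw : Measure (Feat p)) (εLaw : Measure ℝ) [IsProbabilityMeasure ξLaw]
    [IsProbabilityMeasure εLaw] :
    sourcesLaw (latentLaw ξLaw εLaw) N (neighbourEvent u N) ≤ 2 / (N : ℝ≥0∞) := by
  have hne : ∀ᵐ r ∂Measure.pi (fun _ : Fin N => latentLaw ξLaw εLaw), ∀ i j l, j ≠ i → j ≠ l →
      crossDist u (r i).1 (r j).1 ≠ crossDist u (r i).1 (r l).1 := by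
    simp only [ae_all_iff]
    intro i j l hji hjl
    exact (quasiMeasurePreserving_pi (quasiMeasurePreserving_latentLaw ξLaw εLaw)).ae
      (ae_crossDist_ne hp hu hji hjl)
  rw [sourcesLaw, Measure.prod_apply_symm (measurableSet_neighbourEvent u)]
  have hle : ∀ᵐ r ∂Measure.pi (fun _ : Fin N => latentLaw ξLaw εLaw),
      Measure.pi (fun _ : Fin N => clusterLaw) ((fun k => (k, r)) ⁻¹' neighbourEvent u N)
        ≤ 2 / (N : ℝ≥0∞) := by
    filter_upwards [hne] with r hr
    by_cases h : ∃ π : Fin N → Fin N, (∀ i, π i ≠ i) ∧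
      ∀ i l, l ≠ i → crossDist u (r i).1 (r (π i)).1 ≤ crossDist u (r i).1 (r l).1
    · obtain ⟨π, h1, h2⟩ := h
      refine (measure_mono ?_).trans (measure_invariant_le π h1)
      rintro k ⟨π', h1', h2', h3⟩ i
      -- nearest neighbours are unique
      have : π' i = π i := by
        by_contra hne
        exact hr i (π' i) (π i) (h1' i) hne
          (le_antisymm (h2' i _ (h1 i)) (h2 i _ (h1' i)))
      rw [← this]
      exact h3 i
    · have : (fun k => (k, r)) ⁻¹' neighbourEvent u N = ∅ := by
        ext k
        simp only [Set.mem_preimage, Set.mem_empty_iff_false, iff_false]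
        rintro ⟨π, h1, h2, -⟩
        exact h ⟨π, h1, h2⟩
      rw [this]; simp
  refine (lintegral_mono_ae hle).trans ?_
  simp

/-- The event that vanilla mixup mixes within clusters only. -/
def pureEvent (p N : ℕ) : Set (Sources p N × Choices N × Choices N × Choices N) :=
  {q | ∀ i, q.1.1 (q.2.2.2 i).1 = q.1.1 i}

lemma measurableSet_pureEvent : MeasurableSet (pureEvent p N) := by
  refine measurableSet_forall fun i => measurableSet_eq_fun ?_ (by fun_prop)
  exact measurable_eval_index (by fun_prop) (by fun_prop)

lemma lintegral_pureEvent_le {g : ℝ → ℝ} (hg : Measurable g) (θ : Feat p) (n : ℕ)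
    (ρ : Measure (Latent p)) [IsProbabilityMeasure ρ] {α : ℝ} (hα : 0 < α) (σy σx : ℝ) :
    ∫⁻ q, (pureEvent p N).indicator
        (fun q => totalDensity σy σx (rawData g θ n q.1) q.2) q
        ∂(sourcesLaw ρ N).prod (choicesRef₃ α N)
      ≤ 2 / (N : ℝ≥0∞) := by
  have := isFiniteMeasure_choicesRef hα N
  let I : Sources p N → Choices N → ℝ≥0∞ := fun s B =>
    Set.indicator {B : Choices N | ∀ i, s.1 (B i).1 = s.1 i} 1 B
  have hset : MeasurableSet {q : Sources p N × Choices N | ∀ i, q.1.1 (q.2 i).1 = q.1.1 i} :=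
    measurableSet_forall fun i => measurableSet_eq_fun
      (measurable_eval_index (by fun_prop) (by fun_prop)) (by fun_prop)
  have hI : Measurable (Function.uncurry I) :=
    (measurable_one.indicator hset : Measurable ({q : Sources p N × Choices N |
      ∀ i, q.1.1 (q.2 i).1 = q.1.1 i}.indicator (1 : Sources p N × Choices N → ℝ≥0∞)))
  have hV : Measurable (choicesDensity (N := N) (distVanilla (p := p)) 1 0) :=
    measurable_choicesDensity _ _ measurable_distVanilla measurable_const measurable_id
  have hT := measurable_totalDensity_rawData (N := N) hg θ n σy σx
  have e : ∀ q : Sources p N × Choices N × Choices N × Choices N,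
      (pureEvent p N).indicator (fun q => totalDensity σy σx (rawData g θ n q.1) q.2) q
        = totalDensity σy σx (rawData g θ n q.1) q.2 * I q.1 q.2.2.2 := by
    intro q
    by_cases h : q ∈ pureEvent p N
    · rw [Set.indicator_of_mem h]
      have : I q.1 q.2.2.2 = 1 :=
        Set.indicator_of_mem (s := {B : Choices N | ∀ i, q.1.1 (B i).1 = q.1.1 i}) h 1
      rw [this, mul_one]
    · rw [Set.indicator_of_notMem h]
      have : I q.1 q.2.2.2 = 0 :=
        Set.indicator_of_notMem (s := {B : Choices N | ∀ i, q.1.1 (B i).1 = q.1.1 i}) h 1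
      rw [this, mul_zero]
  simp only [e]
  have hpair : Measurable fun q : Sources p N × Choices N × Choices N × Choices N =>
      (q.1, q.2.2.2) := by fun_prop
  have hTI : Measurable fun q : Sources p N × Choices N × Choices N × Choices N =>
      totalDensity σy σx (rawData g θ n q.1) q.2 * I q.1 q.2.2.2 := hT.mul (hI.comp hpair)
  rw [lintegral_prod _ hTI.aemeasurable]
  calc ∫⁻ s, ∫⁻ A, totalDensity σy σx (rawData g θ n s) A * I s A.2.2 ∂choicesRef₃ α N
          ∂sourcesLaw ρ N
      ≤ ∫⁻ s, ∫⁻ B, choicesDensity (distVanilla (p := p)) 1 0 B * I s B ∂choicesRef α N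
          ∂sourcesLaw ρ N := by
        refine lintegral_mono fun s => ?_
        refine (lintegral_totalDensity_le hα σy σx _ (hI.comp measurable_prodMk_left)).trans_eq ?_
        simp only [choicesDensity_distVanilla 1 (rawData g θ n s) 0]
        rfl
    _ = ∫⁻ B, ∫⁻ s, choicesDensity (distVanilla (p := p)) 1 0 B * I s B ∂sourcesLaw ρ N
          ∂choicesRef α N :=
        lintegral_lintegral_swap ((hV.comp measurable_snd).mul hI).aemeasurable
    _ ≤ ∫⁻ B, choicesDensity (distVanilla (p := p)) 1 0 B * (2 / (N : ℝ≥0∞))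
          ∂choicesRef α N := by
        refine lintegral_mono fun B => ?_
        have hIB : Measurable fun s => I s B := hI.comp measurable_prodMk_right
        rw [lintegral_const_mul _ hIB]
        by_cases hB : ∃ i, (B i).1 = i
        · obtain ⟨i, hi⟩ := hB
          rw [choicesDensity_eq_zero _ _ _ hi, zero_mul, zero_mul]
        · push Not at hB
          gcongr
          have hs : {k : Fin N → Fin 2 | ∀ i, k (B i).1 = k i} ×ˢ (Set.univ : Set _)
              = {s : Sources p N | ∀ i, s.1 (B i).1 = s.1 i} := by ext s; simp
          have hm : MeasurableSet {s : Sources p N | ∀ i, s.1 (B i).1 = s.1 i} := by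
            rw [← hs]
            exact (Set.toFinite _).measurableSet.prod MeasurableSet.univ
          have e2 : ∀ s, I s B = {s : Sources p N | ∀ i, s.1 (B i).1 = s.1 i}.indicator 1 s :=
            fun s => rfl
          simp only [e2]
          rw [lintegral_indicator_one hm, ← hs, sourcesLaw, Measure.prod_prod, measure_univ,
            mul_one]
          exact measure_invariant_le _ hB
    _ ≤ 2 / (N : ℝ≥0∞) := by
        rw [lintegral_mul_const _ hV]
        exact mul_le_of_le_one_left' (lintegral_choicesDensity_le_one _ _ hα 0)

lemma lintegral_indicator_sources_le {g : ℝ → ℝ} (hg : Measurable g) (θ : Feat p) (n : ℕ)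
    (ρ : Measure (Latent p)) [IsProbabilityMeasure ρ] {α : ℝ} (hα : 0 < α) (σy σx : ℝ)
    {E : Set (Sources p N)} (hE : MeasurableSet E) :
    ∫⁻ q, (Prod.fst ⁻¹' E).indicator
        (fun q : Sources p N × Choices N × Choices N × Choices N =>
          totalDensity σy σx (rawData g θ n q.1) q.2) q
        ∂(sourcesLaw ρ N).prod (choicesRef₃ α N)
      ≤ sourcesLaw ρ N E := by
  have := isFiniteMeasure_choicesRef hα N
  have hT := measurable_totalDensity_rawData (N := N) hg θ n σy σx
  have hTE : Measurable ((Prod.fst ⁻¹' E).indicator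
      fun q : Sources p N × Choices N × Choices N × Choices N =>
        totalDensity σy σx (rawData g θ n q.1) q.2) :=
    hT.indicator (hE.preimage measurable_fst)
  rw [lintegral_prod _ hTE.aemeasurable, ← lintegral_indicator_one hE]
  refine lintegral_mono fun s => ?_
  by_cases hs : s ∈ E
  · rw [Set.indicator_of_mem hs]
    refine le_trans (lintegral_mono fun A => ?_)
      (lintegral_totalDensity_le_one hα σy σx (rawData g θ n s))
    exact Set.indicator_le_self _ _ _
  · rw [Set.indicator_of_notMem hs]
    have h0 : ∀ A, (Prod.fst ⁻¹' E).indicator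
        (fun q : Sources p N × Choices N × Choices N × Choices N =>
          totalDensity σy σx (rawData g θ n q.1) q.2) (s, A) = 0 := fun A =>
      Set.indicator_of_notMem (s := Prod.fst ⁻¹' E) (a := (s, A)) hs _
    simp only [h0, lintegral_zero, le_refl]

end Exceptional

/-! ### The probability that C-Mixup does not win -/

section Conclusion

variable {p N : ℕ} {g : ℝ → ℝ} {c₀ c₁ : ℝ} {θ : Feat p}

/-- A bound on the asymptotic probability of failure at large scales. -/
noncomputable def failureBound (N : ℕ) : ℝ≥0∞ :=
  (N * 2 : ℕ) * (2 ^ N : ℝ≥0∞)⁻¹ + 2 / N + 2 / N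

/-- Outside the exceptional events, the contribution of almost every realisation to the
probability of failure vanishes at large scales. -/
lemma ae_tendsto_failure (hg : IsLink g c₀ c₁) (hθ : θ ≠ 0) (hN : p + 1 ≤ N)
    (ξLaw : Measure (Feat p)) (εLaw : Measure ℝ) [IsProbabilityMeasure ξLaw]
    [IsProbabilityMeasure εLaw] (hε : MemLp (fun e : ℝ => e) 2 εLaw) {α : ℝ} (hα : 0 < α)
    {σy σx : ℝ} (hσy : 0 < σy) (hσx : 0 < σx) :
    ∀ᵐ q ∂(sourcesLaw (latentLaw ξLaw εLaw) N).prod (choicesRef₃ α N),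
      q ∉ pureEvent p N → q.1 ∉ lonelyEvent p N → q.1 ∉ neighbourEvent (‖θ‖⁻¹ • θ) N →
      Tendsto (fun n => (failureEvent ((clusterLaw.prod (latentLaw ξLaw εLaw)).map (rawObs g θ n))
        (labelUnit g θ n * (1 / 2))).indicator (fun ω => totalDensity σy σx ω.1 ω.2)
          (rawData g θ n q.1, q.2)) atTop (𝓝 0) := by
  have := isFiniteMeasure_choicesRef hα N
  set Q := sourcesLaw (latentLaw ξLaw εLaw) N
  have qC : Measure.QuasiMeasurePreserving (Prod.map id fun A : Choices N × Choices N × Choices N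
      => A.1) (Q.prod (choicesRef₃ α N)) (Q.prod (choicesRef α N)) :=
    MeasureTheory.QuasiMeasurePreserving.prodMap (Measure.QuasiMeasurePreserving.id Q)
      Measure.quasiMeasurePreserving_fst
  have qF : Measure.QuasiMeasurePreserving (Prod.map id fun A : Choices N × Choices N × Choices N
      => A.2.1) (Q.prod (choicesRef₃ α N)) (Q.prod (choicesRef α N)) :=
    MeasureTheory.QuasiMeasurePreserving.prodMap (Measure.QuasiMeasurePreserving.id Q)
      (Measure.quasiMeasurePreserving_fst.comp Measure.quasiMeasurePreserving_snd)
  have qV : Measure.QuasiMeasurePreserving (Prod.map id fun A : Choices N × Choices N × Choices N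
      => A.2.2) (Q.prod (choicesRef₃ α N)) (Q.prod (choicesRef α N)) :=
    MeasureTheory.QuasiMeasurePreserving.prodMap (Measure.QuasiMeasurePreserving.id Q)
      (Measure.quasiMeasurePreserving_snd.comp Measure.quasiMeasurePreserving_snd)
  have hr := ae_fullRank_limMixed (θ := θ) hN ξLaw εLaw hα
  have hg' := (Measure.quasiMeasurePreserving_snd (μ := Q)).ae (ae_choicesRef_goodRatio hα N)
  filter_upwards [qC.ae hr, qF.ae hr, qV.ae hr, qC.ae hg', qF.ae hg', qV.ae hg']
    with ⟨s, AC, AF, AV⟩ rC rF rV gC gF gV hpure hlonely hneigh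
  simp only [Prod.map_apply, id] at rC rF rV gC gF gV
  have hle : ∀ n, (failureEvent ((clusterLaw.prod (latentLaw ξLaw εLaw)).map (rawObs g θ n))
      (labelUnit g θ n * (1 / 2))).indicator (fun ω => totalDensity σy σx ω.1 ω.2)
      (rawData g θ n s, AC, AF, AV) ≤ totalDensity σy σx (rawData g θ n s) (AC, AF, AV) :=
    fun n => Set.indicator_le_self _ _ _
  have squeeze : ∀ f : ℕ → ℝ≥0∞, Tendsto f atTop (𝓝 0) →
      (∀ n, totalDensity σy σx (rawData g θ n s) (AC, AF, AV) ≤ f n) →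
      Tendsto (fun n => (failureEvent ((clusterLaw.prod (latentLaw ξLaw εLaw)).map (rawObs g θ n))
        (labelUnit g θ n * (1 / 2))).indicator (fun ω => totalDensity σy σx ω.1 ω.2)
          (rawData g θ n s, AC, AF, AV)) atTop (𝓝 0) := fun f hf h =>
    tendsto_of_tendsto_of_tendsto_of_le_of_le tendsto_const_nhds hf (fun _ => zero_le)
      fun n => (hle n).trans (h n)
  have hcomp : ∀ i, ∃ j, j ≠ i ∧ s.1 j = s.1 i := by
    simpa [lonelyEvent] using hlonely
  by_cases hC : ∀ i, s.1 (AC i).1 = s.1 i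
  swap
  · push Not at hC
    obtain ⟨i, hi⟩ := hC
    exact squeeze _ (tendsto_choicesDensity_label hg hθ hσy s hcomp hi)
      fun n => totalDensity_le_label _ _ _ _
  by_cases hself : ∃ i, (AF i).1 = i
  · obtain ⟨i, hi⟩ := hself
    refine squeeze (fun _ => 0) tendsto_const_nhds fun n => ?_
    exact (totalDensity_le_feat _ _ _ _).trans_eq (choicesDensity_eq_zero _ _ _ hi)
  push Not at hself
  by_cases hnn : ∀ i l, l ≠ i → crossDist (‖θ‖⁻¹ • θ) (s.2 i).1 (s.2 (AF i).1).1
      ≤ crossDist (‖θ‖⁻¹ • θ) (s.2 i).1 (s.2 l).1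
  swap
  · push Not at hnn
    obtain ⟨i, l, hl, hlt⟩ := hnn
    exact squeeze _ (tendsto_choicesDensity_feat hσx hθ s hl hlt)
      fun n => totalDensity_le_feat _ _ _ _
  have hF : ∃ i, s.1 (AF i).1 ≠ s.1 i := by
    by_contra h
    push Not at h
    exact hneigh ⟨fun i => (AF i).1, hself, hnn, h⟩
  have hV : ∃ i, s.1 (AV i).1 ≠ s.1 i := by
    simpa [pureEvent] using hpure
  have h1 : ∃ i, s.1 i = 1 := by
    obtain ⟨i, hi⟩ := hV
    have h2 : ∀ a b : Fin 2, a ≠ b → a = 1 ∨ b = 1 := by decide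
    rcases h2 _ _ hi with h | h
    · exact ⟨_, h⟩
    · exact ⟨_, h⟩
  refine tendsto_const_nhds.congr' ?_
  filter_upwards [eventually_notMem_failureEvent hg hθ ξLaw εLaw hε s gC gF gV (rC h1) (rF h1)
    (rV h1) hC hF hV] with n hn
  exact (Set.indicator_of_notMem hn _).symm

/-- For large scales, the probability that C-Mixup does not win exceeds a bound that depends on the
sample size only by no more than a prescribed `δ`. -/
lemma eventually_sampleLaw_failure_le (hg : IsLink g c₀ c₁) (hθ : θ ≠ 0) (hp : 2 ≤ p)
    (hN : p + 1 ≤ N) (ξLaw : Measure (Feat p)) (εLaw : Measure ℝ) [IsProbabilityMeasure ξLaw]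
    [IsProbabilityMeasure εLaw] (hε : MemLp (fun e : ℝ => e) 2 εLaw) {α : ℝ} (hα : 0 < α)
    {σy σx : ℝ} (hσy : 0 < σy) (hσx : 0 < σx) {δ : ℝ≥0∞} (hδ : 0 < δ) :
    ∀ᶠ n in atTop,
      sampleLaw ((clusterLaw.prod (latentLaw ξLaw εLaw)).map (rawObs g θ n)) α σy σx N
        (failureEvent ((clusterLaw.prod (latentLaw ξLaw εLaw)).map (rawObs g θ n))
          (labelUnit g θ n * (1 / 2))) ≤ failureBound N + δ := by
  have := isFiniteMeasure_choicesRef hα N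
  have hu : ‖‖θ‖⁻¹ • θ‖ = 1 := norm_smul_inv_norm (𝕜 := ℝ) hθ
  set Q := sourcesLaw (latentLaw ξLaw εLaw) N
  set E := lonelyEvent p N ∪ neighbourEvent (‖θ‖⁻¹ • θ) N
  have hEm : MeasurableSet E :=
    measurableSet_lonelyEvent.union (measurableSet_neighbourEvent _)
  set X : Set (Sources p N × Choices N × Choices N × Choices N) :=
    Prod.fst ⁻¹' E ∪ pureEvent p N
  have hXm : MeasurableSet X := (hEm.preimage measurable_fst).union measurableSet_pureEvent
  let T : ℕ → Sources p N × Choices N × Choices N × Choices N → ℝ≥0∞ := fun n q =>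
    totalDensity σy σx (rawData g θ n q.1) q.2
  let F : ℕ → Sources p N × Choices N × Choices N × Choices N → ℝ≥0∞ := fun n q =>
    (failureEvent ((clusterLaw.prod (latentLaw ξLaw εLaw)).map (rawObs g θ n))
        (labelUnit g θ n * (1 / 2))).indicator (fun ω => totalDensity σy σx ω.1 ω.2)
          (rawData g θ n q.1, q.2)
  have hPm : ∀ n, IsProbabilityMeasure
      ((clusterLaw.prod (latentLaw ξLaw εLaw)).map (rawObs g θ n)) := fun n =>
    Measure.isProbabilityMeasure_map (measurable_rawObs hg.measurable θ n).aemeasurable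
  have hpair : ∀ n, Measurable fun q : Sources p N × Choices N × Choices N × Choices N =>
      ((rawData g θ n q.1, q.2) : Sample p N) := fun n =>
    measurable_prodMk_rawData hg.measurable θ n
  have hFm : ∀ n, Measurable (F n) := fun n =>
    ((measurable_totalDensity σy σx).indicator (measurableSet_failureEvent _ _)).comp (hpair n)
  have hTm : ∀ n, Measurable (T n) := fun n =>
    measurable_totalDensity_rawData hg.measurable θ n σy σx
  have hFT : ∀ n q, F n q ≤ T n q := fun n q => Set.indicator_le_self _ _ _
  -- the contribution of the exceptional events
  have hexc : ∀ n, ∫⁻ q, X.indicator (T n) q ∂Q.prod (choicesRef₃ α N) ≤ failureBound N := by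
    intro n
    calc ∫⁻ q, X.indicator (T n) q ∂Q.prod (choicesRef₃ α N)
        ≤ ∫⁻ q, (Prod.fst ⁻¹' E).indicator (T n) q + (pureEvent p N).indicator (T n) q
            ∂Q.prod (choicesRef₃ α N) := by
          refine lintegral_mono fun q => ?_
          by_cases h1 : q ∈ Prod.fst ⁻¹' E
          · rw [Set.indicator_of_mem (show q ∈ X from Or.inl h1), Set.indicator_of_mem h1]
            exact le_self_add
          · by_cases h2 : q ∈ pureEvent p N
            · rw [Set.indicator_of_mem (show q ∈ X from Or.inr h2), Set.indicator_of_mem h2]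
              exact le_add_self
            · rw [Set.indicator_of_notMem (fun h : q ∈ X => h.elim h1 h2)]
              exact zero_le
      _ = ∫⁻ q, (Prod.fst ⁻¹' E).indicator (T n) q ∂Q.prod (choicesRef₃ α N)
          + ∫⁻ q, (pureEvent p N).indicator (T n) q ∂Q.prod (choicesRef₃ α N) :=
          lintegral_add_left ((hTm n).indicator (hEm.preimage measurable_fst)) _
      _ ≤ Q E + 2 / N := add_le_add
          (lintegral_indicator_sources_le hg.measurable θ n _ hα σy σx hEm)
          (lintegral_pureEvent_le hg.measurable θ n _ hα σy σx)
      _ ≤ failureBound N := by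
          refine add_le_add_left ((measure_union_le _ _).trans (add_le_add ?_ ?_)) _
          · exact measure_lonelyEvent_le _
          · exact measure_neighbourEvent_le hp hu ξLaw εLaw
  -- the remaining contribution vanishes by dominated convergence
  have hrest : Tendsto (fun n => ∫⁻ q, Xᶜ.indicator (F n) q ∂Q.prod (choicesRef₃ α N)) atTop
      (𝓝 0) := by
    have h := tendsto_lintegral_of_dominated_convergence (μ := Q.prod (choicesRef₃ α N))
      (F := fun n => Xᶜ.indicator (F n)) (f := fun _ => 0) (fun _ => 1)
      (fun n => (hFm n).indicator hXm.compl)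
      (fun n => Eventually.of_forall fun q => (Set.indicator_le_self _ _ _).trans
        ((hFT n q).trans (totalDensity_le_one _ _ _ _)))
      (by simp [measure_ne_top]) ?_
    · simpa using h
    filter_upwards [ae_tendsto_failure hg hθ hN ξLaw εLaw hε hα hσy hσx] with q hq
    by_cases hqX : q ∈ X
    · simp only [Set.indicator_of_notMem (fun h : q ∈ Xᶜ => h hqX)]
      exact tendsto_const_nhds
    · simp only [Set.indicator_of_mem (show q ∈ Xᶜ from hqX)]
      exact hq (fun h => hqX (Or.inr h)) (fun h => hqX (Or.inl (Or.inl h)))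
        (fun h => hqX (Or.inl (Or.inr h)))
  filter_upwards [hrest.eventually_le_const hδ] with n hn
  rw [sampleLaw_map_apply hg.measurable θ n _ hα σy σx (measurableSet_failureEvent _ _)]
  calc ∫⁻ q, F n q ∂Q.prod (choicesRef₃ α N)
      ≤ ∫⁻ q, X.indicator (T n) q + Xᶜ.indicator (F n) q ∂Q.prod (choicesRef₃ α N) := by
        refine lintegral_mono fun q => ?_
        by_cases hq : q ∈ X
        · rw [Set.indicator_of_mem hq]
          exact (hFT n q).trans le_self_add
        · rw [Set.indicator_of_notMem hq, Set.indicator_of_mem (show q ∈ Xᶜ from hq), zero_add]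
    _ = ∫⁻ q, X.indicator (T n) q ∂Q.prod (choicesRef₃ α N)
        + ∫⁻ q, Xᶜ.indicator (F n) q ∂Q.prod (choicesRef₃ α N) :=
        lintegral_add_left ((hTm n).indicator hXm) _
    _ ≤ failureBound N + δ := add_le_add (hexc n) hn

lemma tendsto_failureBound : Tendsto failureBound atTop (𝓝 0) := by
  have h1 : Tendsto (fun N : ℕ => 2 / (N : ℝ≥0∞)) atTop (𝓝 0) := by
    have := ENNReal.Tendsto.const_mul (a := 2) ENNReal.tendsto_inv_nat_nhds_zero
      (Or.inr (by simp))
    simpa [div_eq_mul_inv] using this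
  have h2 : Tendsto (fun N : ℕ => ((N * 2 : ℕ) : ℝ≥0∞) * (2 ^ N : ℝ≥0∞)⁻¹) atTop (𝓝 0) := by
    have h := (tendsto_pow_const_div_const_pow_of_one_lt 1 (one_lt_two (α := ℝ))).mul_const 2
    rw [zero_mul] at h
    have h' := (ENNReal.continuous_ofReal.tendsto _).comp h
    rw [ENNReal.ofReal_zero] at h'
    refine h'.congr fun N => ?_
    simp only [Function.comp]
    rw [show (N : ℝ) ^ 1 / 2 ^ N * 2 = ((N * 2 : ℕ) : ℝ) / 2 ^ N by push_cast; ring,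
      ENNReal.ofReal_div_of_pos (by positivity), ENNReal.ofReal_natCast,
      ENNReal.ofReal_pow (by norm_num), ENNReal.ofReal_ofNat, div_eq_mul_inv]
  have h := (h2.add h1).add h1
  rw [add_zero, add_zero] at h
  exact h

end Conclusion

/-! ### The growth conditions -/

/-- Since `θ ≠ 0`, the sparsity condition forces the dimension to be at least `2` eventually. -/
lemma eventually_dimension {p : ℕ → ℕ} {θ : ∀ N : ℕ, Feat (p N)} (hθ : ∀ N, θ N ≠ 0)
    (hs : (fun N => (({i | θ N i ≠ 0} : Set (Fin (p N))).ncard : ℝ)) =o[atTop]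
      fun N => (p N : ℝ))
    (hp : (fun N => (p N : ℝ)) =o[atTop] fun N : ℕ => (N : ℝ)) :
    ∀ᶠ N in atTop, 2 ≤ p N ∧ p N + 1 ≤ N := by
  filter_upwards [hs.def (show (0 : ℝ) < 1 / 2 by norm_num),
    hp.def (show (0 : ℝ) < 1 / 2 by norm_num)] with N h1 h2
  have hne : ({i | θ N i ≠ 0} : Set (Fin (p N))).Nonempty := by
    by_contra h
    rw [Set.not_nonempty_iff_eq_empty] at h
    refine hθ N ?_
    ext i
    by_contra hi
    have : i ∈ ({i | θ N i ≠ 0} : Set (Fin (p N))) := hi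
    rw [h] at this
    exact this
  have h3 : 1 ≤ ({i | θ N i ≠ 0} : Set (Fin (p N))).ncard :=
    (Set.ncard_pos (Set.toFinite _)).2 hne
  have h3' : (1 : ℝ) ≤ (({i | θ N i ≠ 0} : Set (Fin (p N))).ncard : ℝ) := by exact_mod_cast h3
  simp only [Real.norm_natCast] at h1 h2
  have h4 : (2 : ℝ) ≤ p N := by linarith
  have h5 : (p N : ℝ) + 1 ≤ N := by linarith
  exact ⟨by exact_mod_cast h4, by exact_mod_cast h5⟩

end CMixup

theorem theorem1
    (p : ℕ → ℕ) (θ : ∀ N : ℕ, CMixup.Feat (p N)) (hθ : ∀ N, θ N ≠ 0)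
    (hs : (fun N => (({i | θ N i ≠ 0} : Set (Fin (p N))).ncard : ℝ)) =o[atTop]
      fun N => (p N : ℝ))
    (hp : (fun N => (p N : ℝ)) =o[atTop] fun N : ℕ => (N : ℝ))
    (c₀ c₁ : ℝ) (hc₀ : 0 < c₀) (g : ℕ → ℝ → ℝ) (hg : ∀ N, ContDiff ℝ 1 (g N))
    (hg' : ∀ N t, c₀ < deriv (g N) t ∧ deriv (g N) t < c₁)
    (ξLaw : ∀ N : ℕ, Measure (CMixup.Feat (p N))) (σξ : ℕ → ℝ)
    (hξ : ∀ N, CMixup.IsIsotropicNoise (ξLaw N) (σξ N))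
    (εLaw : ℕ → Measure ℝ) (hε : ∀ N, IsProbabilityMeasure (εLaw N)) (τ : ℝ≥0)
    (hετ : ∀ N, HasSubgaussianMGF (fun e : ℝ => e) τ (εLaw N))
    (α : ℝ) (hα : 0 < α) (σy σx : ℕ → ℝ) (hσy : ∀ N, 0 < σy N) (hσx : ∀ N, 0 < σx N) :
    ∃ (K : ℕ) (κ : ℝ → ℝ) (m : ℕ → Fin K → ℝ)
      (S : ∀ N : ℕ, Matrix (Fin (p N)) (Fin (p N)) ℝ) (h : ℕ → ℝ),
      0 < K ∧ CMixup.IsSmoothingKernel κ ∧ (∀ N, (S N).PosDef) ∧ (∀ N, 0 < h N) ∧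
      Tendsto
        (fun N =>
          CMixup.sampleLaw (CMixup.obsLaw (g N) (θ N) (m N) (S N) (ξLaw N) (εLaw N))
            α (σy N) (σx N) N
            {ω | ¬ CMixup.CMixupWins
              (CMixup.obsLaw (g N) (θ N) (m N) (S N) (ξLaw N) (εLaw N)) κ (h N) ω})
        atTop (𝓝 0) := by
  have hξp : ∀ N, IsProbabilityMeasure (ξLaw N) := fun N => (hξ N).isProbabilityMeasure
  have hlink : ∀ N, CMixup.IsLink (g N) c₀ c₁ := fun N =>
    CMixup.isLink_of_deriv hc₀ (hg N) (hg' N)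
  have hεL : ∀ N, MemLp (fun e : ℝ => e) 2 (εLaw N) := fun N => (hετ N).memLp 2
  have hu : ∀ N, ‖‖θ N‖⁻¹ • θ N‖ = 1 := fun N => norm_smul_inv_norm (𝕜 := ℝ) (hθ N)
  -- the scale is chosen after `N`, large enough for the limiting bound to hold up to `1 / N`
  have hex : ∀ N : ℕ, ∃ n : ℕ, 2 ≤ p N ∧ p N + 1 ≤ N →
      CMixup.sampleLaw ((CMixup.clusterLaw.prod (CMixup.latentLaw (ξLaw N) (εLaw N))).map
          (CMixup.rawObs (g N) (θ N) n)) α (σy N) (σx N) N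
        (CMixup.failureEvent ((CMixup.clusterLaw.prod
            (CMixup.latentLaw (ξLaw N) (εLaw N))).map (CMixup.rawObs (g N) (θ N) n))
          (CMixup.labelUnit (g N) (θ N) n * (1 / 2)))
        ≤ CMixup.failureBound N + (N : ℝ≥0∞)⁻¹ := by
    intro N
    by_cases h : 2 ≤ p N ∧ p N + 1 ≤ N
    · obtain ⟨n, hn⟩ := (CMixup.eventually_sampleLaw_failure_le (hlink N) (hθ N) h.1 h.2 (ξLaw N)
        (εLaw N) (hεL N) hα (hσy N) (hσx N) (δ := (N : ℝ≥0∞)⁻¹) (by simp)).exists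
      exact ⟨n, fun _ => hn⟩
    · exact ⟨0, fun h' => absurd h' h⟩
  choose n hn using hex
  refine ⟨2, CMixup.boxKernel, fun N k => CMixup.scale (n N) * CMixup.lab k,
    fun N => CMixup.stretchMatrix (‖θ N‖⁻¹ • θ N) 1 ((CMixup.scale (n N) ^ 2) ^ 2),
    fun N => CMixup.labelUnit (g N) (θ N) (n N) * (1 / 2), two_pos,
    CMixup.isSmoothingKernel_boxKernel, fun N => ?_, fun N => ?_, ?_⟩
  · have := CMixup.scale_pos (n N)
    exact CMixup.stretchMatrix_posDef (hu N) one_pos (by positivity)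
  · have := CMixup.labelUnit_pos (g N) (θ N) (n N)
    positivity
  have hlim : Tendsto (fun N : ℕ => CMixup.failureBound N + (N : ℝ≥0∞)⁻¹) atTop (𝓝 0) := by
    have h := CMixup.tendsto_failureBound.add ENNReal.tendsto_inv_nat_nhds_zero
    rwa [add_zero] at h
  refine tendsto_of_tendsto_of_tendsto_of_le_of_le' tendsto_const_nhds hlim
    (Eventually.of_forall fun _ => zero_le) ?_
  filter_upwards [CMixup.eventually_dimension hθ hs hp] with N hN
  rw [CMixup.obsLaw_eq_map (hlink N).measurable (hθ N)]
  exact (measure_mono (CMixup.subset_failureEvent _ _)).trans (hn N hN)
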